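/- **Normal Form Theorem for computation over Baire space.** *Notation.* Let $\mathcal N=\omega^\omega$ be Baire space. Fix an effective numbering of oracle programs (programs for partial functions $\mathbb N\to\mathbb N$ that may query an oracle $x\in\mathcal N$). Let $\Phi^x(e,i)$ be the result, if any, of the $e$-th program with oracle $x$ on input $i$. Let $\Psi(e;x)=\Phi^x(e)\in\mathcal N$ be the sequence $(\Phi^x(e,i))_{i\in\omega}$, which is undefined if $\Phi^x(e,i)\uparrow$ for some $i$. Finite tuples of points of $\mathcal N$ are used as oracles through their join (interleaving). A partial function $U(z;\vec x)$ from $\mathbb N\times\mathcal N^{q}$ to $\mathcal N$ is *TTE-computable* if one oracle program computes, with oracle $\vec x$, the $i$-th entry of $U(z;\vec x)$ from $(z,i)$, and $U(z;\vec x)$ is undefined exactly when this program diverges for some $i$. *Primitive recursive functions over $\mathcal N$.* Let $e_0,e_1,\dots$ be an effective list of the indices of the oracle programs that use no unbounded search (the programs for functions primitive recursive in the oracle), and let $\Theta(i;x)=\Psi(e_i;x)$. The class of *primitive recursive functions over $\mathcal N$* is the smallest class of functions $\mathbb N^p\times\mathcal N^q\to\mathbb N$ or $\mathbb N^p\times\mathcal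 N^q\to\mathcal N$ that contains zero, successor, the projections, $\Theta(i;\vec x)$ and the characteristic function $\chi$ of $\{0^\omega\}\subseteq\mathcal N$, and is closed under composition (with matching types) and primitive recursion on a number argument. A predicate is *primitive recursive over $\mathcal N$* if its characteristic function is. *Master-slave machines.* An MS-machine consists of a Turing machine (the master), which also has a billboard tape and a Boolean bit and whose states include a slave-calling state $S$ and a zero-test state $E$, together with finitely many tapes that each carry a point of $\mathcal N$ (the slave tapes). In state $S$, if $p$ is the number on the billboard and $y$ is the join of the slave tapes, then $y$ is replaced by $\Phi^y(p)$; if this is undefined, the computation is undefined. In state $E$ the bit is set to $\chi$ of a designated slave tape. Numerical inputs are written in binary on the master's tape, and inputs from $\mathcal N$ on the first slave tapes. When the halting state is reached, the output is the number on the master's tape or the point on a designated slave tape, according to the codomain. A partial function is *MS-computable* if some MS-machine computes it and the function is undefined where the machine does not halt with an output. **Theorem.** Let $p\ge 0$ and $q\ge 1$, and let $Y$ be $\mathbb N$ or $\mathcal N$. There are a predicate $T(e,z,\vec n;\vec x)$, with $e,z\in\mathbb N$, $\vec n\in\mathbb N^p$, $\vec x\in\mathcal N^q$, that is primitive recursive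 over $\mathcal N$, and a partial TTE-computable function $U(z;\vec x)$ with values in $\mathcal N$, such that for every MS-computable partial function $F:\mathbb N^p\times\mathcal N^q\to Y$ there is an $e\in\mathbb N$ such that for all $\vec n\in\mathbb N^p$ and $\vec x\in\mathcal N^q$ $$F(\vec n;\vec x)=U\bigl(\mu z\,T(e,z,\vec n;\vec x);\vec x\bigr),$$ where both sides are undefined or both are defined and equal. If $Y=\mathbb N$, the value $k$ of $F$ is identified with the constant sequence $(k,k,\dots)\in\mathcal N$. In particular ($p=0$, $q=1$, $Y=\mathcal N$), there are $T(e,x,z)$ and $U(z;x)$ such that every MS-computable partial $F:\mathcal N\to\mathcal N$ satisfies $F(x)=U(\mu z\,T(e,x,z);x)$ for some $e$ and all $x\in\mathcal N$. -/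

import Mathlib

namespace BaireComputability

/-- Baire space `ω^ω`. -/
abbrev Baire : Type := ℕ → ℕ

/-! ### Oracle programs and TTE-computable functions -/

/-- Programs for partial functions `ℕ → ℕ` with an oracle: the basic functions, an oracle query,
pairing, composition, primitive recursion and unbounded search. -/
inductive OracleCode : Type
  | zero : OracleCode
  | succ : OracleCode
  | left : OracleCode
  | right : OracleCode
  | query : OracleCode
  | pair : OracleCode → OracleCode → OracleCode
  | comp : OracleCode → OracleCode → OracleCode
  | prec : OracleCode → OracleCode → OracleCode
  | search : OracleCode → OracleCode

namespace OracleCode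

/-- `c.eval x i` is the result, if any, of running the program `c` with oracle `x` on input `i`.
On input `⟨a, m⟩` the program `search c` returns the least `k ≥ m` with `c (⟨a, k⟩) = 0`
such that `c` is defined on all `⟨a, j⟩` with `m ≤ j < k`. -/
def eval (x : Baire) : OracleCode → ℕ →. ℕ
  | zero => fun _ => Part.some 0
  | succ => fun n => Part.some (n + 1)
  | left => fun n => Part.some n.unpair.1
  | right => fun n => Part.some n.unpair.2
  | query => fun n => Part.some (x n)
  | pair f g => fun n => (eval x f n).bind fun a => (eval x g n).map fun b => Nat.pair a b
  | comp f g => fun n => (eval x g n).bind (eval x f)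
  | prec f g => fun n =>
      Nat.rec (eval x f n.unpair.1)
        (fun k ih => ih.bind fun v => eval x g (Nat.pair n.unpair.1 (Nat.pair k v))) n.unpair.2
  | search f => fun n =>
      (Nat.rfind fun k =>
        (eval x f (Nat.pair n.unpair.1 (k + n.unpair.2))).map fun v => decide (v = 0)).map
        fun k => k + n.unpair.2

/-- The effective numbering of oracle programs. -/
def ofNat : ℕ → OracleCode
  | 0 => zero
  | 1 => succ
  | 2 => left
  | 3 => right
  | 4 => query
  | n + 5 =>
    have h : n / 4 < n + 5 := by omega
    have h₁ : (n / 4).unpair.1 < n + 5 := lt_of_le_of_lt (Nat.unpair_left_le _) h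
    have h₂ : (n / 4).unpair.2 < n + 5 := lt_of_le_of_lt (Nat.unpair_right_le _) h
    match n % 4 with
    | 0 => pair (ofNat (n / 4).unpair.1) (ofNat (n / 4).unpair.2)
    | 1 => comp (ofNat (n / 4).unpair.1) (ofNat (n / 4).unpair.2)
    | 2 => prec (ofNat (n / 4).unpair.1) (ofNat (n / 4).unpair.2)
    | _ => search (ofNat (n / 4))

/-- A program is primitive if it uses no unbounded search. -/
def isPrimitive : OracleCode → Bool
  | zero | succ | left | right | query => true
  | pair f g | comp f g | prec f g => isPrimitive f && isPrimitive g
  | search _ => false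

theorem eval_dom_of_isPrimitive (x : Baire) :
    ∀ c : OracleCode, c.isPrimitive = true → ∀ n, (eval x c n).Dom
  | zero, _, _ | succ, _, _ | left, _, _ | right, _, _ | query, _, _ => trivial
  | pair f g, h, n => by
    simp only [isPrimitive, Bool.and_eq_true] at h
    exact ⟨eval_dom_of_isPrimitive x f h.1 n, eval_dom_of_isPrimitive x g h.2 n⟩
  | comp f g, h, n => by
    simp only [isPrimitive, Bool.and_eq_true] at h
    exact ⟨eval_dom_of_isPrimitive x g h.2 n, eval_dom_of_isPrimitive x f h.1 _⟩
  | prec f g, h, n => by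
    simp only [isPrimitive, Bool.and_eq_true] at h
    simp only [eval]
    induction n.unpair.2 with
    | zero => exact eval_dom_of_isPrimitive x f h.1 _
    | succ k ih => exact ⟨ih, eval_dom_of_isPrimitive x g h.2 _⟩
  | search _, h, _ => by simp [isPrimitive] at h

end OracleCode

/-- The point of Baire space with the given entries; undefined as soon as one entry is. -/
def collect (f : ℕ →. ℕ) : Part Baire where
  Dom := ∀ i, (f i).Dom
  get h i := (f i).get (h i)

/-- The universal TTE-computable function `Ψ(e; x)`, also written `Φ^x(e)`. -/
def Psi (e : ℕ) (x : Baire) : Part Baire :=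
  collect ((OracleCode.ofNat e).eval x)

/-- The join (interleaving) of `k + 1` points of Baire space; for `k = 0` it is the identity. -/
def join {k : ℕ} (x : Fin (k + 1) → Baire) : Baire :=
  fun m => x ⟨m % (k + 1), Nat.mod_lt _ k.succ_pos⟩ (m / (k + 1))

/-- The inverse of `join`. -/
def split {k : ℕ} (y : Baire) : Fin (k + 1) → Baire :=
  fun t i => y ((k + 1) * i + t)

/-- TTE-computability of a partial function `U(z; x₀, …, x_q)` with values in Baire space:
one oracle program computes, from `z` and `i`, the `i`-th entry of the value, and the value is
undefined if the program diverges for some `i`. -/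
def TTEComputable {q : ℕ} (U : ℕ → (Fin (q + 1) → Baire) → Part Baire) : Prop :=
  ∃ c : OracleCode, ∀ z x, U z x = collect fun i => c.eval (join x) (Nat.pair z i)

/-! ### Primitive recursive functions over Baire space -/

/-- The recursive list of the indices of the primitive oracle programs: `i` itself if
the `i`-th program is primitive, and otherwise `0`, the index of a program for the zero function. -/
def primitiveIndex (i : ℕ) : ℕ :=
  if (OracleCode.ofNat i).isPrimitive then i else 0

theorem psi_primitiveIndex_dom (i : ℕ) (x : Baire) : (Psi (primitiveIndex i) x).Dom := by
  intro n
  apply OracleCode.eval_dom_of_isPrimitive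
  unfold primitiveIndex
  split_ifs with h
  · exact h
  · simp [OracleCode.ofNat, OracleCode.isPrimitive]

/-- The universal primitive TTE function `Θ(i; x) = Ψ(eᵢ; x)`. -/
def Theta (i : ℕ) (x : Baire) : Baire :=
  (Psi (primitiveIndex i) x).get (psi_primitiveIndex_dom i x)

/-- The two sorts of values: natural numbers and points of Baire space. -/
inductive Srt : Type
  | nat : Srt
  | baire : Srt

/-- The set of values of a given sort. -/
abbrev Srt.Val : Srt → Type
  | .nat => ℕ
  | .baire => Baire

/-- The embedding of values into Baire space: a number `k` becomes the constant sequence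
`(k, k, …)`, a point of Baire space is left unchanged. -/
def Srt.toBaire : (s : Srt) → s.Val → Baire
  | .nat, k => fun _ => k
  | .baire, y => y

open Classical in
/-- The characteristic function of `{0}` in Baire space. -/
noncomputable def chi (x : Baire) : ℕ := if x = 0 then 1 else 0

/-- The class of primitive recursive functions over Baire space, with arguments
`(n₁, …, n_p; x₁, …, x_q)` and values in `ℕ` or in Baire space. -/
inductive PrimRecOver :
    {p q : ℕ} → (s : Srt) → ((Fin p → ℕ) → (Fin q → Baire) → s.Val) → Prop
  | zero : PrimRecOver (p := 1) (q := 0) .nat fun _ _ => (0 : ℕ)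
  | succ : PrimRecOver (p := 1) (q := 0) .nat fun n _ => (n 0 + 1 : ℕ)
  | projNat {p q : ℕ} (i : Fin p) : PrimRecOver (p := p) (q := q) .nat fun n _ => n i
  | projBaire {p q : ℕ} (j : Fin q) : PrimRecOver (p := p) (q := q) .baire fun _ x => x j
  | theta {k : ℕ} : PrimRecOver (p := 1) (q := k + 1) .baire fun n x => Theta (n 0) (join x)
  | chi : PrimRecOver (p := 0) (q := 1) .nat fun _ x => chi (x 0)
  | comp {p q r l : ℕ} {s : Srt} {f : (Fin p → ℕ) → (Fin q → Baire) → s.Val}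
      {g : Fin p → (Fin r → ℕ) → (Fin l → Baire) → ℕ}
      {h : Fin q → (Fin r → ℕ) → (Fin l → Baire) → Baire} :
      PrimRecOver s f → (∀ i, PrimRecOver .nat (g i)) → (∀ j, PrimRecOver .baire (h j)) →
      PrimRecOver s fun m y => f (fun i => g i m y) (fun j => h j m y)
  | recNat {p q : ℕ} {G : (Fin p → ℕ) → (Fin q → Baire) → ℕ}
      {H : (Fin (p + 2) → ℕ) → (Fin q → Baire) → ℕ} :
      PrimRecOver .nat G → PrimRecOver .nat H →
      PrimRecOver (p := p + 1) (q := q) .nat fun n x =>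
        (Nat.rec (G (Fin.tail n) x)
          (fun k v => H (Fin.snoc (α := fun _ => ℕ)
            (Fin.cons (α := fun _ => ℕ) k (Fin.tail n)) v) x) (n 0) : ℕ)
  | recBaire {p q : ℕ} {G : (Fin p → ℕ) → (Fin q → Baire) → Baire}
      {H : (Fin (p + 1) → ℕ) → (Fin (q + 1) → Baire) → Baire} :
      PrimRecOver .baire G → PrimRecOver .baire H →
      PrimRecOver (p := p + 1) (q := q) .baire fun n x =>
        (Nat.rec (G (Fin.tail n) x)
          (fun k v => H (Fin.cons (α := fun _ => ℕ) k (Fin.tail n))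
            (Fin.snoc (α := fun _ => Baire) x v)) (n 0) : Baire)

open Classical in
/-- A predicate is primitive recursive over Baire space if its characteristic function is. -/
def PrimRecPred {p q : ℕ} (T : (Fin p → ℕ) → (Fin q → Baire) → Prop) : Prop :=
  PrimRecOver .nat fun n x => (if T n x then 1 else 0 : ℕ)

open Classical in
/-- `μ z, P z`: the least `z` with `P z`, undefined if there is none. -/
noncomputable def mu (P : ℕ → Prop) : Part ℕ where
  Dom := ∃ z, P z
  get h := Nat.find h

/-! ### Master-slave machines -/

/-- Tape symbols of the master: blank, the two binary digits, and `k` auxiliary symbols. -/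
inductive Symb (k : ℕ) : Type
  | blank : Symb k
  | bit : Bool → Symb k
  | aux : Fin k → Symb k

instance (k : ℕ) : Inhabited (Symb k) := ⟨Symb.blank⟩

/-- `m` in binary, most significant digit first; `0` is written as a single digit. -/
def binary (m : ℕ) : List Bool :=
  if m = 0 then [false] else (Nat.bits m).reverse

/-- The maximal initial block of binary digits. -/
def leadingBits {k : ℕ} : List (Symb k) → List Bool
  | Symb.bit b :: l => b :: leadingBits l
  | _ => []

theorem leadingBits_append_blank {k : ℕ} (n : ℕ) : ∀ l : List (Symb k),
    leadingBits (l ++ List.replicate n default) = leadingBits l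
  | [] => by cases n <;> rfl
  | Symb.blank :: _ => rfl
  | Symb.aux _ :: _ => rfl
  | Symb.bit b :: l => congrArg (b :: ·) (leadingBits_append_blank n l)

/-- The number written on a tape in binary, from the head to the first symbol on the right that is
not a digit. -/
def readNumber {k : ℕ} (t : Turing.Tape (Symb k)) : ℕ :=
  (t.right₀.liftOn leadingBits fun a b h => by
    obtain ⟨n, rfl⟩ := h
    exact (leadingBits_append_blank n a).symm).foldl (fun v b => 2 * v + b.toNat) 0

/-- The states of the master: standard states, the slave-calling state and the zero-test state. -/
inductive MState (m : ℕ) : Type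
  | std : Fin m → MState m
  | call : MState m
  | test : MState m

/-- A master-slave machine for inputs with `q + 1` points of Baire space. The master is a
Turing machine with a work tape (which also carries the numerical input and output), a billboard
tape, and a Boolean bit. The slaves handle `q + w + 1` tapes, each carrying a point of
Baire space; one of them is zero-tested, and one carries the output. -/
structure MSMachine (q : ℕ) where
  numStates : ℕ
  numAux : ℕ
  w : ℕ
  start : Fin numStates
  halt : Fin numStates
  /-- Standard commands: from a standard state, the symbols read on the work tape and on the
  billboard, and the Boolean bit, to a new state and one action on each of the two tapes. -/
  command : Fin numStates → Symb numAux → Symb numAux → Bool →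
    Option (MState numStates × Turing.TM0.Stmt (Symb numAux) × Turing.TM0.Stmt (Symb numAux))
  /-- The state after a slave call. -/
  callNext : Option (MState numStates)
  /-- The state after a zero-test. -/
  testNext : Option (MState numStates)
  testTape : Fin (q + w + 1)
  outTape : Fin (q + w + 1)

namespace MSMachine

variable {q : ℕ}

/-- Configurations: the state, the tapes and the bit of the master, and the tapes of the slaves. -/
structure Cfg (M : MSMachine q) where
  state : MState M.numStates
  work : Turing.Tape (Symb M.numAux)
  board : Turing.Tape (Symb M.numAux)
  bit : Bool
  slaves : Fin (q + M.w + 1) → Baire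

/-- The effect of moving the head or of writing a symbol. -/
def act {k : ℕ} : Turing.TM0.Stmt (Symb k) → Turing.Tape (Symb k) → Turing.Tape (Symb k)
  | Turing.TM0.Stmt.move d, t => t.move d
  | Turing.TM0.Stmt.write a, t => t.write a

/-- One step of the computation. In a slave call with the number `p` on the billboard, the `i`-th
slave computes `Φ^y(p, i)`, where `y` is the join of the current slave tapes; if all slaves
halt, the join of the new slave tapes is `Φ^y(p)`, otherwise there is no next configuration. -/
inductive Yields (M : MSMachine q) : M.Cfg → M.Cfg → Prop
  | standard (C : M.Cfg) (r : Fin M.numStates) (r' : MState M.numStates)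
      (a b : Turing.TM0.Stmt (Symb M.numAux)) :
      C.state = .std r → r ≠ M.halt →
      M.command r C.work.head C.board.head C.bit = some (r', a, b) →
      Yields M C { C with state := r', work := act a C.work, board := act b C.board }
  | call (C : M.Cfg) (r' : MState M.numStates) (y : Baire) :
      C.state = .call → M.callNext = some r' →
      y ∈ Psi (readNumber C.board) (join C.slaves) →
      Yields M C { C with state := r', slaves := split y }
  | test (C : M.Cfg) (r' : MState M.numStates) :
      C.state = .test → M.testNext = some r' →
      Yields M C { C with state := r', bit := decide (chi (C.slaves M.testTape) = 1) }

/-- The initial configuration: the numbers stand in binary, separated by blanks, on the work tape,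
with the head on the first digit; the points of Baire space stand on the first slave tapes;
everything else is blank or zero. -/
def init (M : MSMachine q) {p : ℕ} (n : Fin p → ℕ) (x : Fin (q + 1) → Baire) : M.Cfg where
  state := .std M.start
  work := Turing.Tape.mk₁
    (List.intercalate [Symb.blank] (List.ofFn fun i => (binary (n i)).map Symb.bit))
  board := Turing.Tape.mk₁ []
  bit := false
  slaves t := if h : (t : ℕ) < q + 1 then x ⟨t, h⟩ else 0

/-- The output of sort `s`: the number on the work tape, or the point on the output tape. -/
def output (M : MSMachine q) (C : M.Cfg) : (s : Srt) → s.Val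
  | .nat => readNumber C.work
  | .baire => C.slaves M.outTape

/-- `M` halts on input `(n; x)` with output `y`. -/
def HaltsWith (M : MSMachine q) {p : ℕ} (n : Fin p → ℕ) (x : Fin (q + 1) → Baire)
    (s : Srt) (y : s.Val) : Prop :=
  ∃ C : M.Cfg, Relation.ReflTransGen M.Yields (M.init n x) C ∧
    C.state = .std M.halt ∧ M.output C s = y

end MSMachine

/-- MS-computability over Baire space of a partial function of `p` numbers and `q + 1` points. -/
def MSComputable {p q : ℕ} {s : Srt}
    (F : (Fin p → ℕ) → (Fin (q + 1) → Baire) → Part s.Val) : Prop :=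
  ∃ M : MSMachine q, ∀ n x y, y ∈ F n x ↔ M.HaltsWith n x s y

end BaireComputability

/-! The master sees the slave tapes only through the bit set by zero-tests. Once a Boolean is
conjectured for each step, its run is an oracle-free finite computation on the numerical input. A
run that reaches the halting state yields a list `l` of programs, each to be run with the result of
the preceding one as oracle, and a list `K` of conjectures on which of these iterated sequences are
zero (`exists_simulation`). The value of the machine should then be `iterPsi x l`, and this is what
`U` computes (`tteComputable_iterPsi`); `μ` searches for the conjectures.

The difficulty is that `T` must be total while slave calls may diverge. So `T` never asks whether
the calls are defined. Statements about iterated computations are expressed by certificates, finite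
derivations checkable by a primitive recursive procedure on a prefix of the oracle; `mem_iterPsi`
characterises the values of `iterPsi` by them. A conjecture "not zero" needs a certificate inside
the witness; a conjecture "zero" has to survive all certificates. Hence `T` has the form "for all
`i`, `Check`", with a matrix primitive recursive in a prefix of the oracle. It says that some
`Theta` value is the zero sequence, so a single use of `chi` decides it.

Every witness accepted by `T` has conjectures that are right wherever the sequences concerned are
defined (`consistent_of_check`). The machine then follows the simulation until it halts or meets a
divergent call, and in the latter case `U` diverges too; so it is immaterial which accepted witness
`μ` finds. Conversely, a halting run supplies conjectures that are defined and right, and these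
extend to an accepted witness (`exists_check_of_correct`). The time-bounded evaluator
`Nat.Partrec.Code.evaln` makes `T` independent of the machine: the simulation enters only through
the index `e` of its code. -/

namespace BaireComputability

open Encodable

/-! ### Programs without unbounded search -/

namespace OracleCode

/-- The inverse of the numbering of oracle programs. -/
def toNat : OracleCode → ℕ
  | zero => 0
  | succ => 1
  | left => 2
  | right => 3
  | query => 4
  | pair f g => 4 * Nat.pair (toNat f) (toNat g) + 5
  | comp f g => 4 * Nat.pair (toNat f) (toNat g) + 6
  | prec f g => 4 * Nat.pair (toNat f) (toNat g) + 7
  | search f => 4 * toNat f + 8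

theorem ofNat_pair (m : ℕ) :
    ofNat (4 * m + 5) = pair (ofNat m.unpair.1) (ofNat m.unpair.2) := by
  have h₁ : 4 * m % 4 = 0 := by omega
  have h₂ : 4 * m / 4 = m := by omega
  rw [ofNat]
  simp only [h₁, h₂]

theorem ofNat_comp (m : ℕ) :
    ofNat (4 * m + 6) = comp (ofNat m.unpair.1) (ofNat m.unpair.2) := by
  have h₁ : (4 * m + 1) % 4 = 1 := by omega
  have h₂ : (4 * m + 1) / 4 = m := by omega
  rw [ofNat]
  simp only [h₁, h₂]

theorem ofNat_prec (m : ℕ) :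
    ofNat (4 * m + 7) = prec (ofNat m.unpair.1) (ofNat m.unpair.2) := by
  have h₁ : (4 * m + 2) % 4 = 2 := by omega
  have h₂ : (4 * m + 2) / 4 = m := by omega
  rw [ofNat]
  simp only [h₁, h₂]

theorem ofNat_search (m : ℕ) : ofNat (4 * m + 8) = search (ofNat m) := by
  have h₁ : (4 * m + 3) % 4 = 3 := by omega
  have h₂ : (4 * m + 3) / 4 = m := by omega
  rw [ofNat]
  simp only [h₁, h₂]

@[simp]
theorem ofNat_toNat (c : OracleCode) : ofNat (toNat c) = c := by
  induction c with
  | pair f g hf hg => simp [toNat, ofNat_pair, hf, hg]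
  | comp f g hf hg => simp [toNat, ofNat_comp, hf, hg]
  | prec f g hf hg => simp [toNat, ofNat_prec, hf, hg]
  | search f hf => simp [toNat, ofNat_search, hf]
  | _ => simp [toNat, ofNat]

/-- `c` is a program without unbounded search that computes `f` relative to the oracle. -/
def PrimComputes (c : OracleCode) (f : Baire → ℕ → ℕ) : Prop :=
  c.isPrimitive = true ∧ ∀ x n, c.eval x n = Part.some (f x n)

theorem PrimComputes.of_eq {c : OracleCode} {f g : Baire → ℕ → ℕ} (hc : PrimComputes c f)
    (h : ∀ x n, f x n = g x n) : PrimComputes c g :=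
  ⟨hc.1, fun x n => (hc.2 x n).trans (congrArg _ (h x n))⟩

theorem primComputes_query : PrimComputes query fun x n => x n :=
  ⟨rfl, fun _ _ => rfl⟩

theorem PrimComputes.comp {c d : OracleCode} {f g : Baire → ℕ → ℕ} (hc : PrimComputes c f)
    (hd : PrimComputes d g) : PrimComputes (comp c d) fun x n => f x (g x n) :=
  ⟨by simp [isPrimitive, hc.1, hd.1], fun x n => by
    change (eval x d n).bind (eval x c) = _
    rw [hd.2]
    exact (Part.bind_some _ _).trans (hc.2 _ _)⟩

theorem PrimComputes.pair {c d : OracleCode} {f g : Baire → ℕ → ℕ} (hc : PrimComputes c f)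
    (hd : PrimComputes d g) : PrimComputes (pair c d) fun x n => Nat.pair (f x n) (g x n) :=
  ⟨by simp [isPrimitive, hc.1, hd.1], fun x n => by simp [eval, hc.2, hd.2]⟩

theorem PrimComputes.prec {c d : OracleCode} {f g : Baire → ℕ → ℕ} (hc : PrimComputes c f)
    (hd : PrimComputes d g) : PrimComputes (prec c d) fun x n =>
      Nat.rec (f x n.unpair.1) (fun k v => g x (Nat.pair n.unpair.1 (Nat.pair k v)))
        n.unpair.2 := by
  refine ⟨by simp [isPrimitive, hc.1, hd.1], fun x n => ?_⟩
  simp only [eval]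
  induction n.unpair.2 with
  | zero => simp [hc.2]
  | succ k ih =>
    refine (congrArg (fun o : Part ℕ => o.bind fun v =>
      eval x d (Nat.pair n.unpair.1 (Nat.pair k v))) ih).trans ?_
    exact (Part.bind_some _ _).trans (hd.2 _ _)

/-- The constructors of `Nat.Primrec` correspond one by one to the program constructors other than
`query` and `search`. -/
theorem exists_primComputes_of_natPrimrec {f : ℕ → ℕ} (hf : Nat.Primrec f) :
    ∃ c, PrimComputes c fun _ => f := by
  induction hf with
  | zero => exact ⟨zero, rfl, fun _ _ => rfl⟩
  | succ => exact ⟨succ, rfl, fun _ _ => rfl⟩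
  | left => exact ⟨left, rfl, fun _ _ => rfl⟩
  | right => exact ⟨right, rfl, fun _ _ => rfl⟩
  | pair _ _ ihf ihg =>
    obtain ⟨c, hc⟩ := ihf
    obtain ⟨d, hd⟩ := ihg
    exact ⟨_, hc.pair hd⟩
  | comp _ _ ihf ihg =>
    obtain ⟨c, hc⟩ := ihf
    obtain ⟨d, hd⟩ := ihg
    exact ⟨_, hc.comp hd⟩
  | prec _ _ ihf ihg =>
    obtain ⟨c, hc⟩ := ihf
    obtain ⟨d, hd⟩ := ihg
    exact ⟨_, hc.prec hd⟩

theorem exists_primComputes {f : ℕ → ℕ} (hf : Primrec f) : ∃ c, PrimComputes c fun _ => f :=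
  exists_primComputes_of_natPrimrec (Primrec.nat_iff.1 hf)

end OracleCode

/-- The first `k` entries of `x`, the last one first. -/
def revPrefix (x : Baire) : ℕ → List ℕ
  | 0 => []
  | k + 1 => x k :: revPrefix x k

@[simp]
theorem length_revPrefix (x : Baire) (k : ℕ) : (revPrefix x k).length = k := by
  induction k with
  | zero => rfl
  | succ k ih => simp [revPrefix, ih]

theorem reverse_revPrefix (x : Baire) (k : ℕ) :
    (revPrefix x k).reverse = (List.range k).map x := by
  induction k with
  | zero => rfl
  | succ k ih => simp [revPrefix, ih, List.range_succ]

namespace OracleCode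

/-- The code of `a :: l` is the successor of the pair of the codes of `a` and `l`, so storing the
newest entry in front turns the construction into a plain recursion with one query per step. -/
theorem exists_primComputes_revPrefix :
    ∃ c, PrimComputes c fun x n => encode (revPrefix x n) := by
  obtain ⟨c₀, h₀⟩ := exists_primComputes (Primrec.const (α := ℕ) 0)
  obtain ⟨c₁, h₁⟩ := exists_primComputes (f := fun n => Nat.pair 0 n)
    (Primrec₂.natPair.comp (.const 0) .id)
  obtain ⟨c₂, h₂⟩ := exists_primComputes (f := fun n => n.unpair.2.unpair.1)
    (Primrec.fst.comp (Primrec.unpair.comp (Primrec.snd.comp Primrec.unpair)))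
  obtain ⟨c₃, h₃⟩ := exists_primComputes (f := fun n => n.unpair.2.unpair.2)
    (Primrec.snd.comp (Primrec.unpair.comp (Primrec.snd.comp Primrec.unpair)))
  obtain ⟨c₄, h₄⟩ := exists_primComputes Primrec.succ
  refine ⟨_, ((h₀.prec (h₄.comp ((primComputes_query.comp h₂).pair h₃))).comp h₁).of_eq
    fun x n => ?_⟩
  simp only [Nat.unpair_pair]
  induction n with
  | zero => rfl
  | succ k ih => simp only [ih]; rfl

/-- A function that is primitive recursive in the input and a long prefix of the oracle is
computed by a program without unbounded search. -/
theorem exists_primComputes_of_prefix {f : ℕ → List ℕ → ℕ} {g : ℕ → ℕ} (hf : Primrec₂ f)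
    (hg : Primrec g) : ∃ c, PrimComputes c fun x n => f n (revPrefix x (g n)) := by
  obtain ⟨c₀, h₀⟩ := exists_primComputes hg
  obtain ⟨c₁, h₁⟩ := exists_primComputes_revPrefix
  obtain ⟨c₂, h₂⟩ := exists_primComputes Primrec.id
  obtain ⟨c₃, h₃⟩ := exists_primComputes
    (f := fun n => f n.unpair.1 ((decode (α := List ℕ) n.unpair.2).getD []))
    (hf.comp (Primrec.fst.comp Primrec.unpair) (Primrec.option_getD.comp
      (Primrec.decode.comp (Primrec.snd.comp Primrec.unpair)) (.const [])))
  refine ⟨_, (h₃.comp (h₂.pair (h₁.comp h₀))).of_eq fun x n => ?_⟩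
  simp

/-- There are programs that query the oracle once. -/
theorem exists_primComputes_query {f : ℕ → ℕ → ℕ} {g : ℕ → ℕ} (hf : Primrec₂ f)
    (hg : Primrec g) : ∃ c, PrimComputes c fun x n => f n (x (g n)) := by
  obtain ⟨c₀, h₀⟩ := exists_primComputes hg
  obtain ⟨c₁, h₁⟩ := exists_primComputes Primrec.id
  obtain ⟨c₂, h₂⟩ := exists_primComputes (f := fun n => f n.unpair.1 n.unpair.2)
    (hf.comp (Primrec.fst.comp Primrec.unpair) (Primrec.snd.comp Primrec.unpair))
  refine ⟨_, (h₂.comp (h₁.pair (primComputes_query.comp h₀))).of_eq fun x n => ?_⟩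
  simp

end OracleCode

/-! ### Sequences computed by programs, joins, and iterated calls -/

theorem mem_collect {f : ℕ →. ℕ} {y : Baire} : y ∈ collect f ↔ ∀ i, y i ∈ f i := by
  constructor
  · rintro ⟨h, rfl⟩ i
    exact Part.get_mem _
  · intro h
    exact ⟨fun i => Part.dom_iff_mem.2 ⟨_, h i⟩, funext fun i => Part.get_eq_of_mem (h i) _⟩

theorem mem_Psi {e : ℕ} {x y : Baire} :
    y ∈ Psi e x ↔ ∀ i, y i ∈ (OracleCode.ofNat e).eval x i :=
  mem_collect

theorem Psi_toNat {c : OracleCode} {f : Baire → ℕ → ℕ} (hc : c.PrimComputes f) (x : Baire) :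
    Psi c.toNat x = Part.some (f x) := by
  refine Part.eq_some_iff.2 (mem_Psi.2 fun i => ?_)
  simp [hc.2]

/-- A program without search keeps its own number in the list of primitive indices. -/
theorem Theta_toNat {c : OracleCode} {f : Baire → ℕ → ℕ} (hc : c.PrimComputes f) (x : Baire) :
    Theta c.toNat x = f x := by
  refine Part.get_eq_of_mem ?_ _
  simp [primitiveIndex, hc.1, Psi_toNat hc]

@[simp]
theorem split_join {k : ℕ} (x : Fin (k + 1) → Baire) : split (join x) = x := by
  funext t i
  have h₁ : ((k + 1) * i + t) % (k + 1) = t := by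
    rw [Nat.mul_add_mod, Nat.mod_eq_of_lt t.2]
  have h₂ : ((k + 1) * i + t) / (k + 1) = i := by
    rw [Nat.mul_add_div k.succ_pos, Nat.div_eq_of_lt t.2, add_zero]
  simp only [split, join, h₁, h₂]

@[simp]
theorem join_split {k : ℕ} (y : Baire) : join (split y : Fin (k + 1) → Baire) = y := by
  funext m
  exact congrArg y (Nat.div_add_mod m (k + 1))

/-- The result of running the programs of a list one after the other, the last one first, each with
the result of the preceding one as its oracle. -/
def iterPsi (x : Baire) : List ℕ → Part Baire
  | [] => Part.some x
  | p :: l => (iterPsi x l).bind (Psi p)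

theorem iterPsi_append (x : Baire) (l l' : List ℕ) :
    iterPsi x (l ++ l') = (iterPsi x l').bind fun y => iterPsi y l := by
  induction l with
  | nil => exact (Part.bind_some_right _).symm
  | cons p l ih => simp only [List.cons_append, iterPsi, ih, Part.bind_assoc]

/-! ### Recursive clauses for evaluation -/

namespace OracleCode

theorem mem_eval_pair {y : Baire} {f g : OracleCode} {n v : ℕ} :
    v ∈ (pair f g).eval y n ↔ v.unpair.1 ∈ f.eval y n ∧ v.unpair.2 ∈ g.eval y n := by
  simp only [eval, Part.mem_bind_iff, Part.mem_map_iff]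
  constructor
  · rintro ⟨a, ha, b, hb, rfl⟩
    simpa using ⟨ha, hb⟩
  · rintro ⟨h₁, h₂⟩
    exact ⟨_, h₁, _, h₂, Nat.pair_unpair v⟩

theorem mem_eval_comp {y : Baire} {f g : OracleCode} {n v : ℕ} :
    v ∈ (comp f g).eval y n ↔ ∃ a, a ∈ g.eval y n ∧ v ∈ f.eval y a :=
  Part.mem_bind_iff

theorem eval_prec_zero {y : Baire} {f g : OracleCode} {b : ℕ} :
    (prec f g).eval y (Nat.pair b 0) = f.eval y b := by
  simp [eval]

theorem mem_eval_prec_succ {y : Baire} {f g : OracleCode} {b k v : ℕ} :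
    v ∈ (prec f g).eval y (Nat.pair b (k + 1)) ↔
      ∃ a, a ∈ (prec f g).eval y (Nat.pair b k) ∧
        v ∈ g.eval y (Nat.pair b (Nat.pair k a)) := by
  simp only [eval, Nat.unpair_pair]
  exact Part.mem_bind_iff

theorem mem_eval_search {y : Baire} {f : OracleCode} {b m v : ℕ} :
    v ∈ (search f).eval y (Nat.pair b m) ↔
      ∃ j, 0 ∈ f.eval y (Nat.pair b (j + m)) ∧
        (∀ i < j, ∃ a, a ≠ 0 ∧ a ∈ f.eval y (Nat.pair b (i + m))) ∧ j + m = v := by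
  simp only [eval, Nat.unpair_pair]
  refine (Part.mem_map_iff _).trans (exists_congr fun j => ?_)
  refine (and_congr_left fun _ => Nat.mem_rfind).trans ?_
  refine and_assoc.trans (and_congr ?_ (and_congr_left fun _ => ?_))
  · refine (Part.mem_map_iff _).trans ⟨?_, fun h => ⟨0, h, rfl⟩⟩
    rintro ⟨a, ha, h⟩
    exact of_decide_eq_true h ▸ ha
  · refine forall_congr' fun i => ⟨fun h hi => ?_, fun h hi => ?_⟩
    · obtain ⟨a, ha, h⟩ := (Part.mem_map_iff _).1 (h hi)
      exact ⟨a, of_decide_eq_false h, ha⟩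
    · obtain ⟨a, h, ha⟩ := h hi
      exact (Part.mem_map_iff _).2 ⟨a, ha, decide_eq_false h⟩

end OracleCode

/-! ### Certificates for results of computations -/

/-- A fact `(l, c, n, v)` claims that the program with number `c`, run with the oracle `iterPsi x l`
on input `n`, returns `v`. -/
abbrev Fact : Type := List ℕ × ℕ × ℕ × ℕ

/-- The facts that need no premises, given a finite part of the oracle. -/
def IsLeaf (σ : List ℕ) (F : Fact) : Prop :=
  (F.2.1 = 0 ∧ F.2.2.2 = 0) ∨ (F.2.1 = 1 ∧ F.2.2.2 = F.2.2.1 + 1) ∨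
    (F.2.1 = 2 ∧ F.2.2.2 = F.2.2.1.unpair.1) ∨ (F.2.1 = 3 ∧ F.2.2.2 = F.2.2.1.unpair.2) ∨
    (F.2.1 = 4 ∧ F.1 = [] ∧ σ.reverse[F.2.2.1]? = some F.2.2.2)

instance (σ : List ℕ) (F : Fact) : Decidable (IsLeaf σ F) := by
  unfold IsLeaf
  infer_instance

/-- The premises of a fact that is not a leaf, given an intermediate value `a`. A fact that cannot
be justified is its own premise. -/
def innerPremises (F : Fact) (a : ℕ) : List Fact :=
  if F.2.1 < 4 then [F]
  else if F.2.1 = 4 then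
    if F.1 = [] then [F]
    else [(F.1.tail, F.1.headI, F.2.2.1, F.2.2.2), (F.1.tail, 4, F.2.2.1, a)]
  else if F.2.1 % 4 = 1 then
    [(F.1, ((F.2.1 - 5) / 4).unpair.1, F.2.2.1, F.2.2.2.unpair.1),
      (F.1, ((F.2.1 - 5) / 4).unpair.2, F.2.2.1, F.2.2.2.unpair.2)]
  else if F.2.1 % 4 = 2 then
    [(F.1, ((F.2.1 - 5) / 4).unpair.2, F.2.2.1, a),
      (F.1, ((F.2.1 - 5) / 4).unpair.1, a, F.2.2.2)]
  else if F.2.1 % 4 = 3 then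
    if F.2.2.1.unpair.2 = 0 then
      [(F.1, ((F.2.1 - 5) / 4).unpair.1, F.2.2.1.unpair.1, F.2.2.2)]
    else
      [(F.1, F.2.1, Nat.pair F.2.2.1.unpair.1 (F.2.2.1.unpair.2 - 1), a),
        (F.1, ((F.2.1 - 5) / 4).unpair.2,
          Nat.pair F.2.2.1.unpair.1 (Nat.pair (F.2.2.1.unpair.2 - 1) a), F.2.2.2)]
  else if a = 0 then
    if F.2.2.2 = F.2.2.1.unpair.2 then [(F.1, (F.2.1 - 5) / 4, F.2.2.1, 0)] else [F]
  else
    [(F.1, (F.2.1 - 5) / 4, F.2.2.1, a),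
      (F.1, F.2.1, Nat.pair F.2.2.1.unpair.1 (F.2.2.1.unpair.2 + 1), F.2.2.2)]

/-- The premises from which a fact follows. -/
def premises (σ : List ℕ) (F : Fact) (a : ℕ) : List Fact :=
  if IsLeaf σ F then [] else innerPremises F a

theorem innerPremises_query (p : ℕ) (l : List ℕ) (n v a : ℕ) :
    innerPremises (p :: l, 4, n, v) a = [(l, p, n, v), (l, 4, n, a)] := by
  simp [innerPremises]

theorem innerPremises_pair (l : List ℕ) (m n v a : ℕ) :
    innerPremises (l, 4 * m + 5, n, v) a =
      [(l, m.unpair.1, n, v.unpair.1), (l, m.unpair.2, n, v.unpair.2)] := by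
  have h₀ : ¬ 4 * m + 5 < 4 := by omega
  have h₁ : (4 * m + 5) % 4 = 1 := by omega
  simp [innerPremises, h₀, h₁]

theorem innerPremises_comp (l : List ℕ) (m n v a : ℕ) :
    innerPremises (l, 4 * m + 6, n, v) a = [(l, m.unpair.2, n, a), (l, m.unpair.1, a, v)] := by
  have h₀ : ¬ 4 * m + 6 < 4 := by omega
  have h₁ : (4 * m + 6) % 4 = 2 := by omega
  have h₂ : (4 * m + 1) / 4 = m := by omega
  simp [innerPremises, h₀, h₁, h₂]

theorem innerPremises_prec_zero (l : List ℕ) (m b v a : ℕ) :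
    innerPremises (l, 4 * m + 7, Nat.pair b 0, v) a = [(l, m.unpair.1, b, v)] := by
  have h₀ : ¬ 4 * m + 7 < 4 := by omega
  have h₁ : (4 * m + 7) % 4 = 3 := by omega
  have h₂ : (4 * m + 2) / 4 = m := by omega
  simp [innerPremises, h₀, h₁, h₂]

theorem innerPremises_prec_succ (l : List ℕ) (m b k v a : ℕ) :
    innerPremises (l, 4 * m + 7, Nat.pair b (k + 1), v) a =
      [(l, 4 * m + 7, Nat.pair b k, a), (l, m.unpair.2, Nat.pair b (Nat.pair k a), v)] := by
  have h₀ : ¬ 4 * m + 7 < 4 := by omega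
  have h₁ : (4 * m + 7) % 4 = 3 := by omega
  have h₂ : (4 * m + 2) / 4 = m := by omega
  simp [innerPremises, h₀, h₁, h₂]

theorem innerPremises_search (l : List ℕ) (m b k v a : ℕ) :
    innerPremises (l, 4 * m + 8, Nat.pair b k, v) a =
      if a = 0 then if v = k then [(l, m, Nat.pair b k, 0)]
        else [(l, 4 * m + 8, Nat.pair b k, v)]
      else [(l, m, Nat.pair b k, a), (l, 4 * m + 8, Nat.pair b (k + 1), v)] := by
  have h₀ : ¬ 4 * m + 8 < 4 := by omega
  have h₁ : (4 * m + 8) % 4 = 0 := by omega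
  have h₂ : (4 * m + 3) / 4 = m := by omega
  simp [innerPremises, h₀, h₁, h₂]

/-- A longer prefix keeps the entries already readable, and only leaves that query `x` itself look
at the prefix. -/
theorem isLeaf_of_le {x : Baire} {s t : ℕ} (h : s ≤ t) {F : Fact}
    (hF : IsLeaf (revPrefix x s) F) : IsLeaf (revPrefix x t) F := by
  simp only [IsLeaf, reverse_revPrefix, List.getElem?_map, Option.map_eq_some_iff,
    List.getElem?_eq_some_iff, List.length_range, List.getElem_range] at hF ⊢
  rcases hF with h' | h' | h' | h' | ⟨h₁, h₂, _, ⟨h₃, rfl⟩, h₄⟩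
  · simp [h']
  · simp [h']
  · simp [h']
  · simp [h']
  · exact .inr <| .inr <| .inr <| .inr ⟨h₁, h₂, _, ⟨h₃.trans_le h, rfl⟩, h₄⟩

/-- A longer prefix can only turn a fact into a leaf, which removes its premises. Certificates
therefore stay valid when more of the oracle is read. -/
theorem premises_subset_of_le {x : Baire} {s t : ℕ} (h : s ≤ t) (F : Fact) (a : ℕ) :
    premises (revPrefix x t) F a ⊆ premises (revPrefix x s) F a := by
  unfold premises
  by_cases h₁ : IsLeaf (revPrefix x s) F
  · simp [h₁, isLeaf_of_le h h₁]
  · split_ifs <;> simp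

/-- A certificate is a list of facts, with intermediate values, each of which follows from
facts further down the list. -/
def IsCert (σ : List ℕ) : List (Fact × ℕ) → Prop
  | [] => True
  | e :: D => IsCert σ D ∧ ∀ G ∈ premises σ e.1 e.2, G ∈ D.map Prod.fst

theorem IsCert.of_le {x : Baire} {s t : ℕ} (h : s ≤ t) {D : List (Fact × ℕ)}
    (hD : IsCert (revPrefix x s) D) : IsCert (revPrefix x t) D := by
  induction D with
  | nil => trivial
  | cons e D ih =>
    exact ⟨ih hD.1, fun G hG => hD.2 G (premises_subset_of_le h _ _ hG)⟩

theorem IsCert.append {σ : List ℕ} {D E : List (Fact × ℕ)} (hD : IsCert σ D) (hE : IsCert σ E) :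
    IsCert σ (D ++ E) := by
  induction D with
  | nil => exact hE
  | cons e D ih =>
    refine ⟨ih hD.1, fun G hG => ?_⟩
    exact List.map_append ▸ List.mem_append_left _ (hD.2 G hG)

theorem IsCert.exists_premises {σ : List ℕ} {D : List (Fact × ℕ)} (hD : IsCert σ D) {F : Fact}
    (hF : F ∈ D.map Prod.fst) : ∃ a, ∀ G ∈ premises σ F a, G ∈ D.map Prod.fst := by
  induction D with
  | nil => simp at hF
  | cons e D ih =>
    rw [List.map_cons, List.mem_cons] at hF
    rcases hF with rfl | hF
    · exact ⟨e.2, fun G hG => List.mem_cons_of_mem _ (hD.2 G hG)⟩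
    · obtain ⟨a, ha⟩ := ih hD.1 hF
      exact ⟨a, fun G hG => List.mem_cons_of_mem _ (ha G hG)⟩

/-- A fact is certified if it occurs in a certificate with respect to a part of the oracle. -/
def Certified (x : Baire) (F : Fact) : Prop :=
  ∃ s D, IsCert (revPrefix x s) D ∧ F ∈ D.map Prod.fst

/-- Finitely many certificates merge into one: concatenate them and use the longest of the prefixes.
-/
theorem exists_isCert_of_forall {x : Baire} {α : Type*} (f : α → Fact) (K : List α)
    (h : ∀ κ ∈ K, Certified x (f κ)) :
    ∃ s D, IsCert (revPrefix x s) D ∧ ∀ κ ∈ K, f κ ∈ D.map Prod.fst := by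
  induction K with
  | nil => exact ⟨0, [], trivial, by simp⟩
  | cons κ K ih =>
    obtain ⟨s, D, hD, hκ⟩ := h κ (by simp)
    obtain ⟨t, E, hE, hK⟩ := ih fun κ' h' => h κ' (by simp [h'])
    refine ⟨max s t, D ++ E, (hD.of_le (le_max_left _ _)).append (hE.of_le (le_max_right _ _)),
      fun κ' h' => ?_⟩
    rw [List.map_append, List.mem_append]
    rcases List.mem_cons.1 h' with rfl | h'
    · exact .inl hκ
    · exact .inr (hK κ' h')

theorem Certified.of_premises {x : Baire} {F : Fact} {s : ℕ} (a : ℕ)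
    (h : ∀ G ∈ premises (revPrefix x s) F a, Certified x G) : Certified x F := by
  obtain ⟨t, D, hD, hG⟩ := exists_isCert_of_forall id _ h
  refine ⟨max s t, (F, a) :: D, ⟨hD.of_le (le_max_right _ _), fun G hG' => ?_⟩, by simp⟩
  exact hG G (premises_subset_of_le (le_max_left _ _) _ _ hG')

theorem Certified.of_innerPremises {x : Baire} {F : Fact} (a : ℕ)
    (h : ∀ G ∈ innerPremises F a, Certified x G) : Certified x F := by
  refine .of_premises (s := 0) a fun G hG => h G ?_
  unfold premises at hG
  split_ifs at hG
  · simp at hG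
  · exact hG

theorem Certified.of_isLeaf {x : Baire} {F : Fact} {s : ℕ} (h : IsLeaf (revPrefix x s) F) :
    Certified x F :=
  .of_premises (s := s) 0 fun G hG => by simp [premises, h] at hG

/-! ### Soundness and completeness of certificates -/

/-- The claim of a fact, provided that the oracle is defined. -/
def Fact.Sound (x : Baire) (F : Fact) : Prop :=
  ∀ y ∈ iterPsi x F.1, F.2.2.2 ∈ (OracleCode.ofNat F.2.1).eval y F.2.2.1

theorem exists_eq_of_five_le {c : ℕ} (h : 5 ≤ c) :
    ∃ m, c = 4 * m + 5 ∨ c = 4 * m + 6 ∨ c = 4 * m + 7 ∨ c = 4 * m + 8 :=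
  ⟨(c - 5) / 4, by omega⟩

theorem sound_of_isLeaf {x : Baire} {s : ℕ} {F : Fact} (h : IsLeaf (revPrefix x s) F) :
    F.Sound x := by
  obtain ⟨l, c, n, v⟩ := F
  intro y hy
  simp only [IsLeaf, reverse_revPrefix, List.getElem?_map, Option.map_eq_some_iff,
    List.getElem?_eq_some_iff, List.length_range, List.getElem_range] at h hy ⊢
  rcases h with ⟨rfl, rfl⟩ | ⟨rfl, rfl⟩ | ⟨rfl, rfl⟩ | ⟨rfl, rfl⟩ | ⟨rfl, rfl, _, ⟨-, rfl⟩, rfl⟩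
  · simp [OracleCode.ofNat, OracleCode.eval]
  · simp [OracleCode.ofNat, OracleCode.eval]
  · simp [OracleCode.ofNat, OracleCode.eval]
  · simp [OracleCode.ofNat, OracleCode.eval]
  · simp only [iterPsi, Part.mem_some_iff] at hy
    simp [OracleCode.ofNat, OracleCode.eval, hy]

/-- Each list of premises mirrors one evaluation clause of the program. For an unjustifiable fact
the claim is trivial, since it is its own premise. -/
theorem sound_of_innerPremises {x : Baire} {F : Fact} {a : ℕ}
    (h : ∀ G ∈ innerPremises F a, Fact.Sound x G) : F.Sound x := by
  obtain ⟨l, c, n, v⟩ := F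
  rcases lt_trichotomy c 4 with hc | rfl | hc
  · exact h _ (by simp [innerPremises, hc])
  · cases l with
    | nil => exact h _ (by simp [innerPremises])
    | cons p l =>
      rw [innerPremises_query] at h
      simp only [List.forall_mem_cons] at h
      intro y hy
      obtain ⟨y', hy', hy⟩ := Part.mem_bind_iff.1 hy
      simpa [OracleCode.ofNat, OracleCode.eval] using
        Part.mem_unique (h.1 y' hy') (mem_Psi.1 hy n)
  · obtain ⟨m, rfl | rfl | rfl | rfl⟩ := exists_eq_of_five_le hc
    · rw [innerPremises_pair] at h
      simp only [List.forall_mem_cons] at h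
      intro y hy
      simp only [OracleCode.ofNat_pair]
      exact OracleCode.mem_eval_pair.2 ⟨h.1 y hy, h.2.1 y hy⟩
    · rw [innerPremises_comp] at h
      simp only [List.forall_mem_cons] at h
      intro y hy
      simp only [OracleCode.ofNat_comp]
      exact OracleCode.mem_eval_comp.2 ⟨a, h.1 y hy, h.2.1 y hy⟩
    · rw [← Nat.pair_unpair n] at h ⊢
      generalize n.unpair.1 = b, n.unpair.2 = k at h ⊢
      intro y hy
      simp only [OracleCode.ofNat_prec]
      cases k with
      | zero =>
        rw [innerPremises_prec_zero] at h
        simp only [List.forall_mem_cons] at h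
        rw [OracleCode.eval_prec_zero]
        exact h.1 y hy
      | succ k =>
        rw [innerPremises_prec_succ] at h
        simp only [List.forall_mem_cons] at h
        have h₁ := h.1 y hy
        simp only [OracleCode.ofNat_prec] at h₁
        exact OracleCode.mem_eval_prec_succ.2 ⟨a, h₁, h.2.1 y hy⟩
    · rw [← Nat.pair_unpair n] at h ⊢
      generalize n.unpair.1 = b, n.unpair.2 = k at h ⊢
      rw [innerPremises_search] at h
      intro y hy
      split_ifs at h with h₀ h₁
      · simp only [List.forall_mem_cons] at h
        simp only [OracleCode.ofNat_search]
        exact OracleCode.mem_eval_search.2 ⟨0, by simpa using h.1 y hy, by simp, by simp [h₁]⟩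
      · exact h _ (by simp) y hy
      · simp only [List.forall_mem_cons] at h
        have h₂ := h.2.1 y hy
        simp only [OracleCode.ofNat_search] at h₂ ⊢
        obtain ⟨j, hj, hi, hv⟩ := OracleCode.mem_eval_search.1 h₂
        -- The search started one place later succeeds after `j` steps; the nonzero value `a` at the
        -- present place adds one more.
        refine OracleCode.mem_eval_search.2 ⟨j + 1, ?_, fun i hi' => ?_, by omega⟩
        · rwa [add_right_comm, add_assoc]
        · cases i with
          | zero => exact ⟨a, h₀, by simpa using h.1 y hy⟩
          | succ i =>
            rw [add_right_comm, add_assoc]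
            exact hi i (by omega)

theorem IsCert.sound {x : Baire} {s : ℕ} {D : List (Fact × ℕ)} (hD : IsCert (revPrefix x s) D)
    {F : Fact} (hF : F ∈ D.map Prod.fst) : F.Sound x := by
  induction D generalizing F with
  | nil => simp at hF
  | cons e D ih =>
    rw [List.map_cons, List.mem_cons] at hF
    rcases hF with rfl | hF
    · by_cases h : IsLeaf (revPrefix x s) e.1
      · exact sound_of_isLeaf h
      · refine sound_of_innerPremises (a := e.2) fun G hG => ih hD.1 (hD.2 G ?_)
        simpa [premises, h] using hG
    · exact ih hD.1 hF

theorem Certified.sound {x : Baire} {F : Fact} (h : Certified x F) : F.Sound x := by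
  obtain ⟨s, D, hD, hF⟩ := h
  exact hD.sound hF

/-- A query to a computed sequence is never a leaf, so both its premises are certified. The second
one forces the preceding sequence to be certified at `n` as well, even if `p` never queries that
place; this is what makes totality propagate down the list of calls. -/
theorem Certified.of_cons {x : Baire} {p n v : ℕ} {l : List ℕ}
    (h : Certified x (p :: l, 4, n, v)) :
    Certified x (l, p, n, v) ∧ ∃ a, Certified x (l, 4, n, a) := by
  obtain ⟨s, D, hD, hF⟩ := h
  obtain ⟨a, ha⟩ := hD.exists_premises hF
  have h₁ : ¬ IsLeaf (revPrefix x s) (p :: l, 4, n, v) := by simp [IsLeaf]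
  rw [premises, if_neg h₁, innerPremises_query] at ha
  exact ⟨⟨s, D, hD, ha _ (by simp)⟩, a, s, D, hD, ha _ (by simp)⟩

theorem certified_search {x : Baire} {l : List ℕ} {m b : ℕ} (j k : ℕ)
    (h₀ : Certified x (l, m, Nat.pair b (j + k), 0))
    (h : ∀ i < j, ∃ a, a ≠ 0 ∧ Certified x (l, m, Nat.pair b (i + k), a)) :
    Certified x (l, 4 * m + 8, Nat.pair b k, j + k) := by
  induction j generalizing k with
  | zero =>
    refine .of_innerPremises 0 fun G hG => ?_
    rw [innerPremises_search] at hG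
    simp only [zero_add, ↓reduceIte, List.mem_singleton] at hG h₀
    exact hG ▸ h₀
  | succ j ih =>
    obtain ⟨a, ha, h₁⟩ := h 0 (by omega)
    refine .of_innerPremises a fun G hG => ?_
    rw [innerPremises_search, if_neg ha] at hG
    simp only [List.mem_cons, List.not_mem_nil, or_false] at hG
    rw [zero_add] at h₁
    rw [add_right_comm, add_assoc] at h₀ hG
    rcases hG with rfl | rfl
    · exact h₁
    · refine ih _ h₀ fun i hi => ?_
      rw [← add_assoc, add_right_comm]
      exact h (i + 1) (by omega)

/-- A terminating computation is a finite derivation tree whose oracle queries are covered by `hq`.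
The induction is on the program number, with inner inductions for recursion and search. -/
theorem certified_of_certified_query {x y : Baire} {l : List ℕ}
    (hq : ∀ n, Certified x (l, 4, n, y n)) (c : ℕ) :
    ∀ {n v : ℕ}, v ∈ (OracleCode.ofNat c).eval y n → Certified x (l, c, n, v) := by
  induction c using Nat.strong_induction_on with
  | _ c ih =>
    intro n v hv
    rcases lt_or_ge c 5 with hc | hc
    · interval_cases c
      · refine .of_isLeaf (s := 0) ?_
        simpa [IsLeaf, OracleCode.ofNat, OracleCode.eval] using hv
      · refine .of_isLeaf (s := 0) ?_
        simpa [IsLeaf, OracleCode.ofNat, OracleCode.eval] using hv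
      · refine .of_isLeaf (s := 0) ?_
        simpa [IsLeaf, OracleCode.ofNat, OracleCode.eval] using hv
      · refine .of_isLeaf (s := 0) ?_
        simpa [IsLeaf, OracleCode.ofNat, OracleCode.eval] using hv
      · have h : v = y n := by simpa [OracleCode.ofNat, OracleCode.eval] using hv
        exact h ▸ hq n
    · obtain ⟨m, hm⟩ := exists_eq_of_five_le hc
      have h₁ : m.unpair.1 < c := by have := Nat.unpair_left_le m; omega
      have h₂ : m.unpair.2 < c := by have := Nat.unpair_right_le m; omega
      have h₃ : m < c := by omega
      replace h₁ := @ih _ h₁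
      replace h₂ := @ih _ h₂
      replace h₃ := @ih _ h₃
      clear ih hc
      rcases hm with rfl | rfl | rfl | rfl
      · simp only [OracleCode.ofNat_pair] at hv
        obtain ⟨h, h'⟩ := OracleCode.mem_eval_pair.1 hv
        refine .of_innerPremises 0 ?_
        rw [innerPremises_pair]
        simp only [List.forall_mem_cons]
        exact ⟨h₁ h, h₂ h', by simp⟩
      · simp only [OracleCode.ofNat_comp] at hv
        obtain ⟨a, h, h'⟩ := OracleCode.mem_eval_comp.1 hv
        refine .of_innerPremises a ?_
        rw [innerPremises_comp]
        simp only [List.forall_mem_cons]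
        exact ⟨h₂ h, h₁ h', by simp⟩
      · simp only [OracleCode.ofNat_prec] at hv
        rw [← Nat.pair_unpair n] at hv ⊢
        generalize n.unpair.1 = b, n.unpair.2 = k at hv ⊢
        induction k generalizing v with
        | zero =>
          rw [OracleCode.eval_prec_zero] at hv
          refine .of_innerPremises 0 ?_
          rw [innerPremises_prec_zero]
          simp only [List.forall_mem_cons]
          exact ⟨h₁ hv, by simp⟩
        | succ k ih =>
          obtain ⟨a, h, h'⟩ := OracleCode.mem_eval_prec_succ.1 hv
          refine .of_innerPremises a ?_
          rw [innerPremises_prec_succ]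
          simp only [List.forall_mem_cons]
          exact ⟨ih h, h₂ h', by simp⟩
      · simp only [OracleCode.ofNat_search] at hv
        rw [← Nat.pair_unpair n] at hv ⊢
        generalize n.unpair.1 = b, n.unpair.2 = k at hv ⊢
        obtain ⟨j, hj, hi, rfl⟩ := OracleCode.mem_eval_search.1 hv
        refine certified_search j k (h₃ hj) fun i h => ?_
        obtain ⟨a, ha, h⟩ := hi i h
        exact ⟨a, ha, h₃ h⟩

theorem certified_query_of_mem {x : Baire} {l : List ℕ} :
    ∀ {y : Baire}, y ∈ iterPsi x l → ∀ n, Certified x (l, 4, n, y n) := by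
  induction l with
  | nil =>
    intro y hy n
    obtain rfl : y = x := by simpa [iterPsi] using hy
    refine .of_isLeaf (s := n + 1) (.inr <| .inr <| .inr <| .inr ⟨rfl, rfl, ?_⟩)
    simp [reverse_revPrefix]
  | cons p l ih =>
    intro y hy n
    obtain ⟨y', hy', hy⟩ := Part.mem_bind_iff.1 hy
    refine .of_innerPremises (y' n) ?_
    rw [innerPremises_query]
    simp only [List.forall_mem_cons]
    exact ⟨certified_of_certified_query (ih hy') p (mem_Psi.1 hy n), ih hy' n, by simp⟩

/-- Soundness alone would be vacuous where `iterPsi x l` is undefined. The converse direction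
recovers definedness by descending through the calls. -/
theorem mem_iterPsi {x y : Baire} {l : List ℕ} :
    y ∈ iterPsi x l ↔ ∀ n, Certified x (l, 4, n, y n) := by
  refine ⟨fun hy => certified_query_of_mem hy, ?_⟩
  induction l generalizing y with
  | nil =>
    intro h
    have : y = x := funext fun n => by
      simpa [OracleCode.ofNat, OracleCode.eval] using (h n).sound x (by simp [iterPsi])
    simp [iterPsi, this]
  | cons p l ih =>
    intro h
    -- The extra premises at all places `n` assemble into a total oracle for the last call.
    choose y' hy' using fun n => (h n).of_cons.2
    exact Part.mem_bind_iff.2 ⟨y', ih hy', mem_Psi.2 fun n => (h n).of_cons.1.sound y' (ih hy')⟩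

theorem Certified.eq_of_mem {x y : Baire} {l : List ℕ} {n v : ℕ} (h : Certified x (l, 4, n, v))
    (hy : y ∈ iterPsi x l) : v = y n := by
  simpa [OracleCode.ofNat, OracleCode.eval] using h.sound y hy

/-! ### Primitive recursiveness of certificate checking -/

section

variable {α : Type*} [Primcodable α]

theorem primrecPred_mem_list {β : Type*} [Primcodable β] {f : α → β} {g : α → List β}
    (hf : Primrec f) (hg : Primrec g) : PrimrecPred fun a => f a ∈ g a := by
  have h : PrimrecRel fun (l : List β) (b : β) => ∃ c ∈ l, c = b :=
    PrimrecRel.exists_mem_list Primrec.eq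
  exact (h.comp hg hf).of_eq fun a => by simp

theorem primrecPred_forall_mem {β : Type*} [Primcodable β] {f : α → List β} {R : β → α → Prop}
    (hR : PrimrecRel R) (hf : Primrec f) : PrimrecPred fun a => ∀ b ∈ f a, R b a :=
  (PrimrecRel.forall_mem_list hR).comp hf .id

theorem primrecPred_exists_mem {β : Type*} [Primcodable β] {f : α → List β} {R : β → α → Prop}
    (hR : PrimrecRel R) (hf : Primrec f) : PrimrecPred fun a => ∃ b ∈ f a, R b a :=
  (PrimrecRel.exists_mem_list hR).comp hf .id

theorem primrec_unpair_fst {f : α → ℕ} (hf : Primrec f) : Primrec fun a => (f a).unpair.1 :=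
  Primrec.fst.comp (Primrec.unpair.comp hf)

theorem primrec_unpair_snd {f : α → ℕ} (hf : Primrec f) : Primrec fun a => (f a).unpair.2 :=
  Primrec.snd.comp (Primrec.unpair.comp hf)

theorem primrec_fact {f : α → List ℕ} {g h k : α → ℕ} (hf : Primrec f) (hg : Primrec g)
    (hh : Primrec h) (hk : Primrec k) : Primrec fun a => ((f a, g a, h a, k a) : Fact) :=
  hf.pair (hg.pair (hh.pair hk))

theorem primrec_singleton {β : Type*} [Primcodable β] {f : α → β} (hf : Primrec f) :
    Primrec fun a => [f a] :=
  Primrec.list_cons.comp hf (.const [])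

theorem primrec_doubleton {β : Type*} [Primcodable β] {f g : α → β} (hf : Primrec f)
    (hg : Primrec g) : Primrec fun a => [f a, g a] :=
  Primrec.list_cons.comp hf (primrec_singleton hg)

theorem primrecPred_isLeaf {σ : α → List ℕ} {F : α → Fact} (hσ : Primrec σ) (hF : Primrec F) :
    PrimrecPred fun a => IsLeaf (σ a) (F a) := by
  have hl : Primrec fun a => (F a).1 := Primrec.fst.comp hF
  have hc : Primrec fun a => (F a).2.1 := Primrec.fst.comp (Primrec.snd.comp hF)
  have hn : Primrec fun a => (F a).2.2.1 :=
    Primrec.fst.comp (Primrec.snd.comp (Primrec.snd.comp hF))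
  have hv : Primrec fun a => (F a).2.2.2 :=
    Primrec.snd.comp (Primrec.snd.comp (Primrec.snd.comp hF))
  have hk (k : ℕ) : PrimrecPred fun a => (F a).2.1 = k := Primrec.eq.comp hc (.const k)
  exact ((hk 0).and (Primrec.eq.comp hv (.const 0))).or <|
    ((hk 1).and (Primrec.eq.comp hv (Primrec.succ.comp hn))).or <|
    ((hk 2).and (Primrec.eq.comp hv (primrec_unpair_fst hn))).or <|
    ((hk 3).and (Primrec.eq.comp hv (primrec_unpair_snd hn))).or <|
    (hk 4).and <| (Primrec.eq.comp hl (.const [])).and <|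
    Primrec.eq.comp (Primrec.list_getElem?.comp (Primrec.list_reverse.comp hσ) hn)
      (Primrec.option_some.comp hv)

theorem primrec_innerPremises {F : α → Fact} {w : α → ℕ} (hF : Primrec F) (hw : Primrec w) :
    Primrec fun a => innerPremises (F a) (w a) := by
  have hl : Primrec fun a => (F a).1 := Primrec.fst.comp hF
  have hc : Primrec fun a => (F a).2.1 := Primrec.fst.comp (Primrec.snd.comp hF)
  have hn : Primrec fun a => (F a).2.2.1 :=
    Primrec.fst.comp (Primrec.snd.comp (Primrec.snd.comp hF))
  have hv : Primrec fun a => (F a).2.2.2 :=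
    Primrec.snd.comp (Primrec.snd.comp (Primrec.snd.comp hF))
  have hm : Primrec fun a => ((F a).2.1 - 5) / 4 :=
    Primrec.nat_div.comp (Primrec.nat_sub.comp hc (.const 5)) (.const 4)
  have hr (k : ℕ) : PrimrecPred fun a => (F a).2.1 % 4 = k :=
    Primrec.eq.comp (Primrec.nat_mod.comp hc (.const 4)) (.const k)
  have hp : Primrec fun a => (F a).2.2.1.unpair.2 - 1 := Primrec.pred.comp (primrec_unpair_snd hn)
  unfold innerPremises
  refine Primrec.ite (Primrec.nat_lt.comp hc (.const 4)) (primrec_singleton hF) ?_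
  refine Primrec.ite (Primrec.eq.comp hc (.const 4)) (Primrec.ite (Primrec.eq.comp hl (.const []))
    (primrec_singleton hF) (primrec_doubleton
      (primrec_fact (Primrec.list_tail.comp hl) (Primrec.list_headI.comp hl) hn hv)
      (primrec_fact (Primrec.list_tail.comp hl) (.const 4) hn hw))) ?_
  refine Primrec.ite (hr 1) (primrec_doubleton
    (primrec_fact hl (primrec_unpair_fst hm) hn (primrec_unpair_fst hv))
    (primrec_fact hl (primrec_unpair_snd hm) hn (primrec_unpair_snd hv))) ?_
  refine Primrec.ite (hr 2) (primrec_doubleton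
    (primrec_fact hl (primrec_unpair_snd hm) hn hw)
    (primrec_fact hl (primrec_unpair_fst hm) hw hv)) ?_
  refine Primrec.ite (hr 3) (Primrec.ite (Primrec.eq.comp (primrec_unpair_snd hn) (.const 0))
    (primrec_singleton (primrec_fact hl (primrec_unpair_fst hm) (primrec_unpair_fst hn) hv))
    (primrec_doubleton
      (primrec_fact hl hc (Primrec₂.natPair.comp (primrec_unpair_fst hn) hp) hw)
      (primrec_fact hl (primrec_unpair_snd hm)
        (Primrec₂.natPair.comp (primrec_unpair_fst hn) (Primrec₂.natPair.comp hp hw)) hv))) ?_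
  exact Primrec.ite (Primrec.eq.comp hw (.const 0))
    (Primrec.ite (Primrec.eq.comp hv (primrec_unpair_snd hn))
      (primrec_singleton (primrec_fact hl hm hn (.const 0))) (primrec_singleton hF))
    (primrec_doubleton (primrec_fact hl hm hn hw) (primrec_fact hl hc (Primrec₂.natPair.comp
      (primrec_unpair_fst hn) (Primrec.succ.comp (primrec_unpair_snd hn))) hv))

theorem primrec_premises {σ : α → List ℕ} {F : α → Fact} {w : α → ℕ} (hσ : Primrec σ)
    (hF : Primrec F) (hw : Primrec w) : Primrec fun a => premises (σ a) (F a) (w a) :=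
  Primrec.ite (primrecPred_isLeaf hσ hF) (.const []) (primrec_innerPremises hF hw)

theorem primrec_facts {D : α → List (Fact × ℕ)} (hD : Primrec D) :
    Primrec fun a => (D a).map Prod.fst :=
  Primrec.list_map hD (Primrec.fst.comp Primrec.snd)

theorem primrecPred_isCert {σ : α → List ℕ} {D : α → List (Fact × ℕ)} (hσ : Primrec σ)
    (hD : Primrec D) : PrimrecPred fun a => IsCert (σ a) (D a) := by
  classical
  -- Checking is a recursion along the list that carries the verdict on the tail as a Boolean.
  have hstep : PrimrecPred fun b : α × (Fact × ℕ) × List (Fact × ℕ) × Bool =>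
      b.2.2.2 = true ∧
        ∀ G ∈ premises (σ b.1) b.2.1.1 b.2.1.2, G ∈ b.2.2.1.map Prod.fst := by
    refine (Primrec.eq.comp (Primrec.snd.comp (Primrec.snd.comp Primrec.snd)) (.const true)).and ?_
    refine primrecPred_forall_mem (R := fun (G : Fact) (b : α × (Fact × ℕ) × List (Fact × ℕ) × Bool)
      => G ∈ b.2.2.1.map Prod.fst) ?_ ?_
    · exact (primrecPred_mem_list Primrec.fst (primrec_facts (Primrec.fst.comp (Primrec.snd.comp
        (Primrec.snd.comp Primrec.snd))))).primrecRel
    · exact primrec_premises (hσ.comp Primrec.fst)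
        (Primrec.fst.comp (Primrec.fst.comp Primrec.snd))
        (Primrec.snd.comp (Primrec.fst.comp Primrec.snd))
  have h := Primrec.list_rec hD (.const true) hstep.decide.to₂
  refine Primrec.primrecPred (h.of_eq fun a => ?_)
  induction D a with
  | nil => exact (decide_eq_true (p := IsCert (σ a) []) trivial).symm
  | cons e E ih => 
    simp only [ih, decide_eq_true_eq]
    exact decide_eq_decide.2 Iff.rfl

end

/-- An entry is found by searching for a certificate of its value. If some entry has no certificate,
the search for it diverges, in agreement with `mem_iterPsi`. -/
theorem tteComputable_iterPsi {q : ℕ} {f : ℕ → List ℕ} (hf : Primrec f) :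
    TTEComputable fun z (x : Fin (q + 1) → Baire) => iterPsi (join x) (f z) := by
  classical
  let dec (k : ℕ) : ℕ × List (Fact × ℕ) := (decode k.unpair.1).getD (0, [])
  have hdec : Primrec dec := Primrec.option_getD.comp
    (Primrec.decode.comp (primrec_unpair_fst .id)) (.const (0, []))
  let R (n : ℕ) (σ : List ℕ) : Prop := IsCert σ (dec n.unpair.2).2 ∧
    (f n.unpair.1.unpair.1, 4, n.unpair.1.unpair.2, (dec n.unpair.2).1) ∈
      (dec n.unpair.2).2.map Prod.fst
  have hR : PrimrecPred fun a : ℕ × List ℕ => R a.1 a.2 := by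
    have h₁ : Primrec fun a : ℕ × List ℕ => dec a.1.unpair.2 :=
      hdec.comp (primrec_unpair_snd Primrec.fst)
    have h₂ : Primrec fun a : ℕ × List ℕ => a.1.unpair.1 := primrec_unpair_fst Primrec.fst
    exact (primrecPred_isCert Primrec.snd (Primrec.snd.comp h₁)).and
      (primrecPred_mem_list (primrec_fact (hf.comp (primrec_unpair_fst h₂)) (.const 4)
        (primrec_unpair_snd h₂) (Primrec.fst.comp h₁)) (primrec_facts (Primrec.snd.comp h₁)))
  obtain ⟨c, hc⟩ := OracleCode.exists_primComputes_of_prefix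
    (f := fun n σ => if R n σ then 0 else 1) (g := fun n => n.unpair.2)
    (Primrec.ite hR (.const 0) (.const 1)) (primrec_unpair_snd .id)
  obtain ⟨c₁, h₁⟩ := OracleCode.exists_primComputes (f := fun n => Nat.pair n 0)
    (Primrec₂.natPair.comp .id (.const 0))
  obtain ⟨c₂, h₂⟩ := OracleCode.exists_primComputes (f := fun n => (dec n).1)
    (Primrec.fst.comp hdec)
  have key (x : Baire) (n v : ℕ) : v ∈ (c₂.comp (c.search.comp c₁)).eval x n ↔
      ∃ j, R (Nat.pair n j) (revPrefix x j) ∧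
        (∀ i < j, ¬ R (Nat.pair n i) (revPrefix x i)) ∧ v = (dec j).1 := by
    rw [OracleCode.mem_eval_comp]
    simp only [OracleCode.mem_eval_comp, h₁.2, h₂.2, Part.mem_some_iff, exists_eq_left,
      OracleCode.mem_eval_search, hc.2, Nat.unpair_pair, add_zero]
    constructor
    · rintro ⟨_, ⟨j, hj, hi, rfl⟩, rfl⟩
      refine ⟨j, by simpa using hj, fun i h => ?_, rfl⟩
      obtain ⟨a, ha, rfl⟩ := hi i h
      simpa using ha
    · rintro ⟨j, hj, hi, rfl⟩
      exact ⟨j, ⟨j, by simpa using hj, fun i h => by simpa using hi i h, rfl⟩, rfl⟩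
  have key₁ {x : Baire} {z i v : ℕ}
      (hv : v ∈ (c₂.comp (c.search.comp c₁)).eval x (Nat.pair z i)) :
      Certified x (f z, 4, i, v) := by
    obtain ⟨j, hj, -, rfl⟩ := (key _ _ _).1 hv
    exact ⟨j, _, by simpa [R] using hj⟩
  have key₂ {x : Baire} {z i v : ℕ} (h : Certified x (f z, 4, i, v)) :
      ∃ v, v ∈ (c₂.comp (c.search.comp c₁)).eval x (Nat.pair z i) := by
    obtain ⟨s, D, hD, hF⟩ := h
    have hj : ∃ j, R (Nat.pair (Nat.pair z i) j) (revPrefix x j) := by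
      -- The search index `j` also serves as the length of the prefix. Pairing with `s` makes `j` at
      -- least `s`, so `D` remains a certificate.
      refine ⟨Nat.pair (encode (v, D)) s, ?_⟩
      simp only [R, dec, Nat.unpair_pair, encodek, Option.getD_some]
      exact ⟨hD.of_le (Nat.right_le_pair _ _), hF⟩
    exact ⟨_, (key _ _ _).2 ⟨Nat.find hj, Nat.find_spec hj, fun i h => Nat.find_min hj h, rfl⟩⟩
  refine ⟨c₂.comp (c.search.comp c₁), fun z x => Part.ext fun y => ?_⟩
  refine Iff.trans ?_ mem_collect.symm
  constructor
  · intro hy i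
    obtain ⟨v, hv⟩ := key₂ (mem_iterPsi.1 hy i)
    -- The search may find a certificate other than the given one, but soundness fixes the value.
    exact (key₁ hv).eq_of_mem hy ▸ hv
  · intro hy
    exact mem_iterPsi.2 fun i => key₁ (hy i)

/-! ### The predicate of the normal form -/

/-- Witnesses: the programs of the slave calls, an auxiliary input, a time bound, the conjectured
results of zero-tests, and a certificate together with the length of the part of the
oracle it depends on. -/
abbrev Witness : Type :=
  List ℕ × ℕ × ℕ × List (List ℕ × Bool) × List (Fact × ℕ) × ℕ

/-- The witness with a given number. -/
def witness (z : ℕ) : Witness := (decode z).getD ([], 0, 0, [], [], 0)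

theorem primrec_witness : Primrec witness :=
  Primrec.option_getD.comp Primrec.decode (.const _)

@[simp]
theorem witness_encode (W : Witness) : witness (encode W) = W := by
  simp [witness]

/-- `F` claims that the sequence computed by the programs of `l` is not zero. -/
def Refutes (F : Fact) (l : List ℕ) : Prop :=
  F.1 = l ∧ F.2.1 = 4 ∧ F.2.2.2 ≠ 0

/-- The condition on a witness that can be checked on the finite part `σ` of the oracle and on
the list `E` of facts. -/
def Check (e : ℕ) (n : List ℕ) (W : Witness) (E : List (Fact × ℕ)) (σ : List ℕ) : Prop :=
  Nat.Partrec.Code.evaln W.2.2.1 (Denumerable.ofNat Nat.Partrec.Code e) (encode (n, W.2.1)) =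
      some (encode (some (W.1, W.2.2.2.1))) ∧
    (¬ IsCert σ E ∨
      ∀ F ∈ E.map Prod.fst, ∀ κ ∈ W.2.2.2.1, ¬ (κ.2 = true ∧ Refutes F κ.1)) ∧
    (σ.length < W.2.2.2.2.2 ∨ (IsCert σ W.2.2.2.2.1 ∧
      ∀ κ ∈ W.2.2.2.1, κ.2 = true ∨ ∃ F ∈ W.2.2.2.2.1.map Prod.fst, Refutes F κ.1))

section

variable {α : Type*} [Primcodable α]

theorem primrecPred_refutes {F : α → Fact} {l : α → List ℕ} (hF : Primrec F)
    (hl : Primrec l) : PrimrecPred fun a => Refutes (F a) (l a) :=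
  (Primrec.eq.comp (Primrec.fst.comp hF) hl).and <|
    (Primrec.eq.comp (Primrec.fst.comp (Primrec.snd.comp hF)) (.const 4)).and
    (Primrec.eq.comp (Primrec.snd.comp (Primrec.snd.comp (Primrec.snd.comp hF))) (.const 0)).not

theorem primrecPred_check {e : α → ℕ} {n σ : α → List ℕ} {W : α → Witness}
    {E : α → List (Fact × ℕ)} (he : Primrec e) (hn : Primrec n) (hW : Primrec W)
    (hE : Primrec E) (hσ : Primrec σ) :
    PrimrecPred fun a => Check (e a) (n a) (W a) (E a) (σ a) := by
  have hW₁ := Primrec.snd.comp hW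
  have hW₂ := Primrec.snd.comp hW₁
  have hW₃ := Primrec.snd.comp hW₂
  have hW₄ := Primrec.snd.comp hW₃
  have hK : Primrec fun a => (W a).2.2.2.1 := Primrec.fst.comp hW₃
  have hD : Primrec fun a => (W a).2.2.2.2.1 := Primrec.fst.comp hW₄
  refine PrimrecPred.and ?_ (PrimrecPred.and ?_ ?_)
  · refine Primrec.eq.comp (Nat.Partrec.Code.primrec_evaln.comp
      (((Primrec.fst.comp hW₂).pair ((Primrec.ofNat _).comp he)).pair
        (Primrec.encode.comp (hn.pair (Primrec.fst.comp hW₁))))) ?_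
    exact Primrec.option_some.comp (Primrec.encode.comp (Primrec.option_some.comp
      ((Primrec.fst.comp hW).pair hK)))
  · refine (primrecPred_isCert hσ hE).not.or (primrecPred_forall_mem
      (R := fun (F : Fact) a => ∀ κ ∈ (W a).2.2.2.1, ¬ (κ.2 = true ∧ Refutes F κ.1))
      ?_ (primrec_facts hE))
    refine PrimrecPred.primrecRel (p := fun b : Fact × α =>
      ∀ κ ∈ (W b.2).2.2.2.1, ¬ (κ.2 = true ∧ Refutes b.1 κ.1)) ?_
    refine primrecPred_forall_mem (R := fun (κ : List ℕ × Bool) (b : Fact × α) =>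
      ¬ (κ.2 = true ∧ Refutes b.1 κ.1)) ?_ (hK.comp Primrec.snd)
    exact ((Primrec.eq.comp (Primrec.snd.comp Primrec.fst) (.const true)).and
      (primrecPred_refutes (Primrec.fst.comp Primrec.snd)
        (Primrec.fst.comp Primrec.fst))).not.primrecRel
  · refine (Primrec.nat_lt.comp (Primrec.list_length.comp hσ) (Primrec.snd.comp hW₄)).or
      ((primrecPred_isCert hσ hD).and (primrecPred_forall_mem
        (R := fun (κ : List ℕ × Bool) a => κ.2 = true ∨
          ∃ F ∈ (W a).2.2.2.2.1.map Prod.fst, Refutes F κ.1) ?_ hK))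
    refine PrimrecPred.primrecRel (p := fun b : (List ℕ × Bool) × α => b.1.2 = true ∨
      ∃ F ∈ (W b.2).2.2.2.2.1.map Prod.fst, Refutes F b.1.1) ?_
    refine (Primrec.eq.comp (Primrec.snd.comp Primrec.fst) (.const true)).or
      (primrecPred_exists_mem (R := fun (F : Fact) (b : (List ℕ × Bool) × α) =>
        Refutes F b.1.1) ?_ (primrec_facts (hD.comp Primrec.snd)))
    exact (primrecPred_refutes Primrec.fst
      (Primrec.fst.comp (Primrec.fst.comp Primrec.snd))).primrecRel

end

/-- The conjectured results of zero-tests are right as far as they are defined. -/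
def Consistent (x : Baire) (K : List (List ℕ × Bool)) : Prop :=
  ∀ κ ∈ K, ∀ y ∈ iterPsi x κ.1, κ.2 = true ↔ y = 0

/-- The conjectured results of zero-tests are defined and right. -/
def Correct (x : Baire) (K : List (List ℕ × Bool)) : Prop :=
  ∀ κ ∈ K, ∃ y ∈ iterPsi x κ.1, κ.2 = true ↔ y = 0

/-! ### What accepted witnesses say about zero-tests -/

section

variable {x : Baire} {e : ℕ} {n : List ℕ}

/-- A nonzero entry would have a certificate, and the quantifier over `i` reaches it, which refutes
a conjecture "zero". A conjecture "not zero" is backed by the certificate in the witness, which is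
sound if the sequence is defined. -/
theorem consistent_of_check {W : Witness}
    (h : ∀ i, Check e n W ((decode i.unpair.1).getD []) (revPrefix x i)) :
    Consistent x W.2.2.2.1 := by
  intro κ hκ y hy
  constructor
  · intro hb
    funext i
    by_contra hi
    obtain ⟨s, E, hE, hF⟩ := mem_iterPsi.1 hy i
    -- This index codes the certificate `E` and is at least `s`, so enough of the oracle is read.
    have h₁ := (h (Nat.pair (encode E) s)).2.1
    rw [Nat.unpair_pair, encodek, Option.getD_some] at h₁
    rcases h₁ with h₁ | h₁
    · exact h₁ (hE.of_le (Nat.right_le_pair _ _))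
    · exact h₁ _ hF κ hκ ⟨hb, rfl, rfl, hi⟩
  · rintro rfl
    -- Here the prefix has exactly the length stored in the witness, so the certificate in it can no
    -- longer be excused.
    rcases (h W.2.2.2.2.2).2.2 with h₁ | ⟨h₁, h₂⟩
    · simp at h₁
    · refine (h₂ κ hκ).resolve_right ?_
      rintro ⟨⟨l, c, i, v⟩, hF, h₃, h₄, h₅⟩
      simp only at h₃ h₄ h₅
      subst h₃ h₄
      exact h₅ (Certified.eq_of_mem ⟨_, _, h₁, hF⟩ hy)

/-- Each right conjecture "not zero" has a certified nonzero entry, and one certificate covers them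
all. Right conjectures "zero" cannot be refuted, by soundness. -/
theorem exists_check_of_correct {l : List ℕ} {w k : ℕ} {K : List (List ℕ × Bool)}
    (hK : Correct x K)
    (h : Nat.Partrec.Code.evaln k (Denumerable.ofNat Nat.Partrec.Code e) (encode (n, w)) =
      some (encode (some (l, K)))) :
    ∃ D s, ∀ i E, Check e n (l, w, k, K, D, s) E (revPrefix x i) := by
  have hF : ∀ κ ∈ K, ∃ F, Certified x F ∧ (κ.2 = true ∨ Refutes F κ.1) := by
    intro κ hκ
    obtain ⟨y, hy, h⟩ := hK κ hκ
    by_cases hb : κ.2 = true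
    · exact ⟨([], 0, 0, 0), .of_isLeaf (s := 0) (.inl ⟨rfl, rfl⟩), .inl hb⟩
    · obtain ⟨i, hi⟩ := Function.ne_iff.1 fun h' => hb (h.2 h')
      exact ⟨_, mem_iterPsi.1 hy i, .inr ⟨rfl, rfl, hi⟩⟩
  choose! f hf using hF
  obtain ⟨s, D, hD, hfD⟩ := exists_isCert_of_forall f K fun κ hκ => (hf κ hκ).1
  refine ⟨D, s, fun i E => ⟨h, or_iff_not_imp_left.2 fun hE => ?_, ?_⟩⟩
  · rintro ⟨l', c, j, v⟩ hF κ hκ ⟨hb, h₁, h₂, h₃⟩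
    simp only at h₁ h₂ h₃
    subst h₁ h₂
    obtain ⟨y, hy, h⟩ := hK κ hκ
    refine h₃ ?_
    rw [Certified.eq_of_mem ⟨_, _, not_not.1 hE, hF⟩ hy, h.1 hb]
    rfl
  · rw [length_revPrefix]
    refine (lt_or_ge i s).imp_right fun hs => ⟨hD.of_le hs, fun κ hκ => ?_⟩
    exact (hf κ hκ).2.imp_right fun h => ⟨_, hfD κ hκ, h⟩

end

/-! ### Coding numbers and points into one oracle -/

/-- Numbers and points of Baire space together as points of Baire space. -/
def params {p q : ℕ} (v : Fin (p + 2) → ℕ) (x : Fin (q + 1) → Baire) :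
    Fin (p + 2 + q + 1) → Baire :=
  fun t => if h : (t : ℕ) < p + 2 then fun _ => v ⟨t, h⟩ else x ⟨t - (p + 2), by omega⟩

theorem join_params_of_lt {p q m : ℕ} (v : Fin (p + 2) → ℕ) (x : Fin (q + 1) → Baire)
    (h : m < p + 2) : join (params v x) m = v ⟨m, h⟩ := by
  have h₁ : m % (p + 2 + q + 1) = m := Nat.mod_eq_of_lt (by omega)
  simp [join, params, h₁, h]

/-- The position in `join (params v x)` of the `m`-th entry of `join x`. -/
def paramsIndex (p q m : ℕ) : ℕ :=
  (p + 2 + q + 1) * (m / (q + 1)) + (p + 2 + m % (q + 1))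

theorem primrec_paramsIndex (p q : ℕ) : Primrec (paramsIndex p q) :=
  Primrec.nat_add.comp
    (Primrec.nat_mul.comp (.const _) (Primrec.nat_div.comp .id (.const _)))
    (Primrec.nat_add.comp (.const _) (Primrec.nat_mod.comp .id (.const _)))

theorem join_params {p q : ℕ} (v : Fin (p + 2) → ℕ) (x : Fin (q + 1) → Baire) (m : ℕ) :
    join (params v x) (paramsIndex p q m) = join x m := by
  have h : m % (q + 1) < q + 1 := Nat.mod_lt m q.succ_pos
  have h₁ : p + 2 + m % (q + 1) < p + 2 + q + 1 := by omega
  have h₂ : ((p + 2 + q + 1) * (m / (q + 1)) + (p + 2 + m % (q + 1))) % (p + 2 + q + 1) =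
      p + 2 + m % (q + 1) := by
    rw [Nat.mul_add_mod, Nat.mod_eq_of_lt h₁]
  have h₃ : ((p + 2 + q + 1) * (m / (q + 1)) + (p + 2 + m % (q + 1))) / (p + 2 + q + 1) =
      m / (q + 1) := by
    rw [Nat.mul_add_div (by omega), Nat.div_eq_of_lt h₁, add_zero]
  simp [join, params, paramsIndex, h₂, h₃]

theorem paramsIndex_lt (p q : ℕ) {m i : ℕ} (h : m < i) :
    paramsIndex p q m < (p + 2 + q + 1) * (i + 1) := by
  have h₁ : m % (q + 1) < q + 1 := Nat.mod_lt m q.succ_pos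
  have h₂ := Nat.mul_le_mul_left (p + 2 + q + 1) ((Nat.div_le_self m (q + 1)).trans h.le)
  rw [paramsIndex, Nat.mul_succ]
  omega

/-! ### Functions primitive recursive over Baire space -/

theorem primRecOver_zero {p q : ℕ} :
    PrimRecOver (p := p) (q := q + 1) .nat fun _ _ => (0 : ℕ) :=
  -- The basic zero function takes one number. As `p` may be `0`, that number is manufactured from a
  -- point by `chi`.
  .comp (g := fun _ _ x => chi (x 0)) (h := fun j _ _ => j.elim0) .zero
    (fun _ => .comp (g := fun i _ _ => i.elim0) (h := fun _ _ x => x 0) .chi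
      (fun i => i.elim0) (fun _ => .projBaire 0)) (fun j => j.elim0)

theorem primRecOver_const {p q : ℕ} (k : ℕ) :
    PrimRecOver (p := p) (q := q + 1) .nat fun _ _ => k := by
  induction k with
  | zero => exact primRecOver_zero
  | succ k ih =>
    exact .comp (g := fun _ _ _ => k) (h := fun j _ _ => j.elim0) .succ (fun _ => ih)
      (fun j => j.elim0)

theorem PrimRecOver.theta_comp {p q k i : ℕ}
    {h : Fin (k + 1) → (Fin p → ℕ) → (Fin (q + 1) → Baire) → Baire}
    (hh : ∀ j, PrimRecOver .baire (h j)) :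
    PrimRecOver .baire fun n x => Theta i (join fun j => h j n x) :=
  .comp (g := fun _ _ _ => i) .theta (fun _ => primRecOver_const i) hh

/-- A number becomes a constant sequence by recursion on it: start from the zero sequence and add
one to all entries at each step. This lets `Theta`, at a fixed index, read numerical arguments
through its oracle. -/
theorem primRecOver_constSeq {p q : ℕ} (i : Fin p) :
    PrimRecOver (p := p) (q := q + 1) .baire fun n _ _ => n i := by
  obtain ⟨c₀, h₀⟩ := OracleCode.exists_primComputes (.const 0)
  obtain ⟨c₁, h₁⟩ := OracleCode.exists_primComputes_query (f := fun _ v => v + 1)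
    (Primrec.succ.comp Primrec.snd) Primrec.id
  have hG : PrimRecOver (p := 0) (q := q + 1) .baire fun _ x =>
      Theta c₀.toNat (join fun _ : Fin 1 => x 0) :=
    .theta_comp fun _ => .projBaire 0
  have hH : PrimRecOver (p := 1) (q := q + 2) .baire fun _ x =>
      Theta c₁.toNat (join fun _ : Fin 1 => x (Fin.last (q + 1))) :=
    .theta_comp fun _ => .projBaire (Fin.last (q + 1))
  have h := PrimRecOver.comp (g := fun _ n _ => n i) (h := fun j _ x => x j) (hG.recBaire hH)
    (fun _ => .projNat i) (fun j => .projBaire j)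
  convert h using 3 with n x
  change (fun _ => n i) = _
  generalize n i = k
  induction k with
  | zero => exact (Theta_toNat h₀ _).symm
  | succ k ih =>
    refine Eq.trans ?_ (Theta_toNat h₁ _).symm
    refine Eq.trans ?_ (congrArg (fun (y : Baire) (m : ℕ) => join (fun _ : Fin 1 => y) m + 1)
      (ih.trans (Fin.snoc_last (α := fun _ => Baire) _ x).symm))
    rfl

theorem primRecPred_theta_eq_zero (p q i : ℕ) :
    PrimRecPred fun (v : Fin (p + 2) → ℕ) (x : Fin (q + 1) → Baire) =>
      Theta i (join (params v x)) = 0 := by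
  refine .comp (g := fun i _ _ => i.elim0)
    (h := fun _ v x => Theta i (join (params v x))) .chi (fun i => i.elim0) fun _ => ?_
  refine .theta_comp fun t => ?_
  by_cases ht : (t : ℕ) < p + 2
  · simp only [params, ht, ↓reduceDIte]
    exact primRecOver_constSeq _
  · simp only [params, ht, ↓reduceDIte]
    exact .projBaire _

theorem mem_mu {P : ℕ → Prop} {z : ℕ} : z ∈ mu P → P z := by
  classical
  rintro ⟨h, rfl⟩
  exact Nat.find_spec h

theorem exists_mem_mu {P : ℕ → Prop} (h : ∃ z, P z) : ∃ z, z ∈ mu P :=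
  ⟨_, h, rfl⟩

/-- A partial function has a normal form if the sequence of programs which computes its value can be
found by an oracle-free search that makes conjectures on results of zero-tests. -/
theorem exists_normalForm (p q : ℕ) :
    ∃ (T : (Fin (p + 2) → ℕ) → (Fin (q + 1) → Baire) → Prop)
      (U : ℕ → (Fin (q + 1) → Baire) → Part Baire), PrimRecPred T ∧ TTEComputable U ∧
      ∀ (F : (Fin p → ℕ) → (Fin (q + 1) → Baire) → Part Baire)
        (G : List ℕ → ℕ → Option (List ℕ × List (List ℕ × Bool))), Primrec₂ G →
        (∀ n x w l K, G (List.ofFn n) w = some (l, K) → Consistent (join x) K →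
          F n x = iterPsi (join x) l) →
        (∀ n x, (F n x).Dom → ∃ w l K, G (List.ofFn n) w = some (l, K) ∧ Correct (join x) K) →
        ∃ e : ℕ, ∀ n x, F n x =
          (mu fun z => T (Matrix.vecCons e (Matrix.vecCons z n)) x).bind fun z => U z x := by
  classical
  let R (i : ℕ) (σ : List ℕ) : Prop :=
    Check (σ.reverse[0]?.getD 0) ((σ.reverse.drop 2).take p)
      (witness (σ.reverse[1]?.getD 0)) ((decode i.unpair.1).getD [])
      ((List.range i).map fun m => σ.reverse[paramsIndex p q m]?.getD 0).reverse
  have hR : PrimrecPred fun a : ℕ × List ℕ => R a.1 a.2 := by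
    have h : Primrec fun a : ℕ × List ℕ => a.2.reverse := Primrec.list_reverse.comp Primrec.snd
    refine primrecPred_check ?_ ?_ ?_ ?_ ?_
    · exact Primrec.option_getD.comp (Primrec.list_getElem?.comp h (.const 0)) (.const 0)
    · exact Primrec.list_take.comp (.const p) (Primrec.list_drop.comp (.const 2) h)
    · exact primrec_witness.comp
        (Primrec.option_getD.comp (Primrec.list_getElem?.comp h (.const 1)) (.const 0))
    · exact Primrec.option_getD.comp
        (Primrec.decode.comp (primrec_unpair_fst Primrec.fst)) (.const [])
    · exact Primrec.list_reverse.comp (Primrec.list_map (Primrec.list_range.comp Primrec.fst)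
        (Primrec.option_getD.comp (Primrec.list_getElem?.comp (h.comp Primrec.fst)
          ((primrec_paramsIndex p q).comp Primrec.snd)) (.const 0)))
  obtain ⟨c, hc⟩ := OracleCode.exists_primComputes_of_prefix
    -- The first block of this prefix contains `e`, `z` and the numbers `n`; the remaining ones
    -- suffice for the first `i` entries of `join x`. The value `0` means that the check succeeds.
    (f := fun n σ => if R n σ then 0 else 1) (g := fun i => (p + 2 + q + 1) * (i + 1))
    (Primrec.ite hR (.const 0) (.const 1)) (Primrec.nat_mul.comp (.const _) Primrec.succ)
  have hT (e z : ℕ) (n : Fin p → ℕ) (x : Fin (q + 1) → Baire) :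
      Theta c.toNat (join (params (Matrix.vecCons e (Matrix.vecCons z n)) x)) = 0 ↔
        ∀ i, Check e (List.ofFn n) (witness z) ((decode i.unpair.1).getD [])
          (revPrefix (join x) i) := by
    rw [Theta_toNat hc, funext_iff]
    refine forall_congr' fun i => ?_
    have hlen : p + 2 + q + 1 ≤ (p + 2 + q + 1) * (i + 1) := Nat.le_mul_of_pos_right _ i.succ_pos
    have h₀ {m : ℕ} (hm : m < (p + 2 + q + 1) * (i + 1)) :
        ((List.range ((p + 2 + q + 1) * (i + 1))).map
          (join (params (Matrix.vecCons e (Matrix.vecCons z n)) x)))[m]?.getD 0 =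
            join (params (Matrix.vecCons e (Matrix.vecCons z n)) x) m := by
      rw [List.getElem?_map, List.getElem?_range hm]
      rfl
    have h₁ := h₀ (m := 0) (by omega)
    rw [join_params_of_lt _ _ (by omega : 0 < p + 2)] at h₁
    have h₂ := h₀ (m := 1) (by omega)
    rw [join_params_of_lt _ _ (by omega : 1 < p + 2)] at h₂
    have h₃ : (((List.range ((p + 2 + q + 1) * (i + 1))).map
        (join (params (Matrix.vecCons e (Matrix.vecCons z n)) x))).drop 2).take p =
          List.ofFn n := by
      refine List.ext_getElem
        (by simp only [List.length_take, List.length_drop, List.length_map, List.length_range,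
          List.length_ofFn]; omega) fun j hj hj' => ?_
      rw [List.length_ofFn] at hj'
      simp only [List.getElem_take, List.getElem_drop, List.getElem_map, List.getElem_range,
        List.getElem_ofFn]
      rw [join_params_of_lt _ _ (by omega)]
      simp only [Nat.add_comm 2 j]
      rfl
    have h₄ : (List.range i).map (fun m => ((List.range ((p + 2 + q + 1) * (i + 1))).map
        (join (params (Matrix.vecCons e (Matrix.vecCons z n)) x)))[paramsIndex p q m]?.getD 0) =
          (List.range i).map (join x) := by
      refine List.map_congr_left fun m hm => ?_
      rw [h₀ (paramsIndex_lt p q (List.mem_range.1 hm)), join_params]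
    have h₅ : ((List.range i).map (join x)).reverse = revPrefix (join x) i := by
      rw [← reverse_revPrefix, List.reverse_reverse]
    simp only [R, reverse_revPrefix, h₁, h₂, h₃, h₄, h₅, Pi.zero_apply, ite_eq_left_iff,
      one_ne_zero, imp_false, not_not]
    rfl
  refine ⟨_, _, primRecPred_theta_eq_zero p q c.toNat,
    tteComputable_iterPsi (f := fun z => (witness z).1) (Primrec.fst.comp primrec_witness),
    fun F G hG h₁ h₂ => ?_⟩
  -- The search `G` becomes a numerical function, so that a code for it can serve as the index `e`.
  let g (m : ℕ) : ℕ := encode (((decode m : Option (List ℕ × ℕ)).map fun a => G a.1 a.2).getD none)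
  have hg : Primrec g := Primrec.encode.comp (Primrec.option_getD.comp
    (Primrec.option_map Primrec.decode (hG.comp (Primrec.fst.comp Primrec.snd)
      (Primrec.snd.comp Primrec.snd))) (.const none))
  obtain ⟨d, hd⟩ := Nat.Partrec.Code.exists_code.1
    (Nat.Partrec.of_primrec (Primrec.nat_iff.1 hg))
  have hd' (n : List ℕ) (w v : ℕ) : v ∈ d.eval (encode (n, w)) ↔ v = encode (G n w) := by
    rw [hd]
    simp [g]
  refine ⟨encode d, fun n x => Part.ext fun y => ?_⟩
  simp only [hT]
  have h₃ {z : ℕ} (hz : ∀ i, Check (encode d) (List.ofFn n) (witness z)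
      ((decode i.unpair.1).getD []) (revPrefix (join x) i)) :
      F n x = iterPsi (join x) (witness z).1 := by
    refine h₁ n x (witness z).2.1 _ (witness z).2.2.2.1 ?_ (consistent_of_check hz)
    -- The clause on `evaln` does not depend on `i`, so any instance will do.
    have h := (hz 0).1
    rw [Denumerable.ofNat_encode] at h
    exact (encode_injective ((hd' _ _ _).1 (Nat.Partrec.Code.evaln_sound h))).symm
  constructor
  · intro hy
    obtain ⟨w, l, K, hG', hK⟩ := h₂ n x (Part.dom_iff_mem.2 ⟨y, hy⟩)
    obtain ⟨k, hk⟩ := Nat.Partrec.Code.evaln_complete.1 ((hd' _ w _).2 (congrArg encode hG').symm)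
    have hk' : Nat.Partrec.Code.evaln k (Denumerable.ofNat Nat.Partrec.Code (encode d))
        (encode (List.ofFn n, w)) = some (encode (some (l, K))) := by
      rw [Denumerable.ofNat_encode]
      exact hk
    obtain ⟨D, s, hD⟩ := exists_check_of_correct hK hk'
    have hz : ∃ z, ∀ i, Check (encode d) (List.ofFn n) (witness z)
        ((decode i.unpair.1).getD []) (revPrefix (join x) i) :=
      ⟨encode (l, w, k, K, D, s), fun i => by
        rw [witness_encode]
        exact hD i _⟩
    -- The least accepted witness may differ from the one constructed; `h₃` applies to every
    -- accepted one.
    obtain ⟨z, hz⟩ := exists_mem_mu hz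
    exact Part.mem_bind_iff.2 ⟨z, hz, h₃ (mem_mu hz) ▸ hy⟩
  · intro hy
    obtain ⟨z, hz, hy⟩ := Part.mem_bind_iff.1 hy
    rw [h₃ (mem_mu hz)]
    exact hy

/-! ### Programs for the slave tapes -/

namespace OracleCode

/-- A program for a constant function. -/
def const : ℕ → OracleCode
  | 0 => zero
  | k + 1 => comp succ (const k)

theorem primComputes_const (k : ℕ) : PrimComputes (const k) fun _ _ => k := by
  induction k with
  | zero => exact ⟨rfl, fun _ _ => rfl⟩
  | succ k ih => exact PrimComputes.comp (c := succ) (f := fun _ n => n + 1) ⟨rfl, fun _ _ => rfl⟩ ih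

/-- Numerical outputs are known only to the simulation, so the program that returns them must be
found primitive recursively from the value. -/
theorem primrec_toNat_const : Primrec fun k => (const k).toNat := by
  have h : Primrec₂ fun (_ : ℕ) (a : ℕ × ℕ) => 4 * Nat.pair 1 a.2 + 6 :=
    Primrec.nat_add.comp (Primrec.nat_mul.comp (.const 4)
      (Primrec₂.natPair.comp (.const 1) (Primrec.snd.comp Primrec.snd))) (.const 6)
  refine (Primrec.nat_rec (.const 0) h |>.comp Primrec.id Primrec.id).of_eq fun k => ?_
  induction k with
  | zero => rfl
  | succ k ih => exact congrArg (fun m => 4 * Nat.pair 1 m + 6) ih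

theorem exists_primComputes_split {k : ℕ} (t : Fin (k + 1)) :
    ∃ c, PrimComputes c fun y => split y t :=
  exists_primComputes_query (f := fun _ v => v) (g := fun i => (k + 1) * i + t) Primrec.snd
    (Primrec.nat_add.comp (Primrec.nat_mul.comp (.const _) .id) (.const _))

end OracleCode

/-- The initial contents of the slave tapes. -/
def initSlaves {q : ℕ} (w : ℕ) (x : Fin (q + 1) → Baire) : Fin (q + w + 1) → Baire :=
  fun t => if h : (t : ℕ) < q + 1 then x ⟨t, h⟩ else 0

theorem OracleCode.exists_primComputes_initSlaves (q w : ℕ) :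
    ∃ c, PrimComputes c fun y => join (initSlaves w (split y : Fin (q + 1) → Baire)) := by
  have h : Primrec fun m => m % (q + w + 1) := Primrec.nat_mod.comp .id (.const _)
  obtain ⟨c, hc⟩ := OracleCode.exists_primComputes_query
    (f := fun m v => if m % (q + w + 1) < q + 1 then v else 0)
    (g := fun m => (q + 1) * (m / (q + w + 1)) + m % (q + w + 1))
    (Primrec.ite (Primrec.nat_lt.comp (h.comp Primrec.fst) (.const _)) Primrec.snd (.const 0))
    (Primrec.nat_add.comp (Primrec.nat_mul.comp (.const _) (Primrec.nat_div.comp .id (.const _))) h)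
  refine ⟨c, hc.of_eq fun y m => ?_⟩
  simp only [join, initSlaves]
  split_ifs <;> rfl

/-! ### Finite codes for the data of the master -/

section

variable {k m : ℕ}

/-- Tape symbols as elements of a standard finite type. -/
def Symb.equiv (k : ℕ) : Symb k ≃ Option (Bool ⊕ Fin k) where
  toFun
    | .blank => none
    | .bit b => some (.inl b)
    | .aux i => some (.inr i)
  invFun
    | none => .blank
    | some (.inl b) => .bit b
    | some (.inr i) => .aux i
  left_inv := by rintro (_ | _ | _) <;> rfl
  right_inv := by rintro (_ | _ | _) <;> rfl

/-- States as elements of a standard finite type. -/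
def MState.equiv (m : ℕ) : MState m ≃ Option (Option (Fin m)) where
  toFun
    | .call => none
    | .test => some none
    | .std r => some (some r)
  invFun
    | none => .call
    | some none => .test
    | some (some r) => .std r
  left_inv := by rintro (_ | _ | _) <;> rfl
  right_inv := by rintro (_ | _ | _) <;> rfl

instance : Primcodable (Symb k) := Primcodable.ofEquiv _ (Symb.equiv k)
instance : Finite (Symb k) := Finite.of_equiv _ (Symb.equiv k).symm
instance : Primcodable (MState m) := Primcodable.ofEquiv _ (MState.equiv m)
instance : Finite (MState m) := Finite.of_equiv _ (MState.equiv m).symm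
instance : DecidableEq (MState m) := (MState.equiv m).decidableEq

/-- Two finite lists that represent a tape: the symbols to the left of the head, and those from
the head to the right. -/
abbrev TapeRep (k : ℕ) : Type := List (Symb k) × List (Symb k)

/-- The represented tape. -/
def TapeRep.toTape (t : TapeRep k) : Turing.Tape (Symb k) := Turing.Tape.mk₂ t.1 t.2

/-- A code for an action on a tape; `none` stands for no action. -/
abbrev ActCode (k : ℕ) : Type := Option (Bool ⊕ Symb k)

/-- The code for a statement. -/
def actCode : Turing.TM0.Stmt (Symb k) → ActCode k
  | .move .left => some (.inl false)
  | .move .right => some (.inl true)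
  | .write a => some (.inr a)

/-- The effect of an action on a representation. -/
def TapeRep.act (t : TapeRep k) (a : ActCode k) : TapeRep k :=
  Option.casesOn a t fun a => Sum.casesOn a
    (fun b => bif b then (t.2.headI :: t.1, t.2.tail) else (t.1.tail, t.1.headI :: t.2))
    (fun s => (t.1, s :: t.2.tail))

theorem TapeRep.toTape_act (t : TapeRep k) (a : Turing.TM0.Stmt (Symb k)) :
    (t.act (actCode a)).toTape = MSMachine.act a t.toTape := by
  obtain ⟨l, r⟩ := t
  rcases a with (_ | _) | a
  · simp [TapeRep.act, actCode, toTape, MSMachine.act, Turing.Tape.mk₂]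
  · simp [TapeRep.act, actCode, toTape, MSMachine.act, Turing.Tape.mk₂]
  · simp [TapeRep.act, actCode, toTape, MSMachine.act, Turing.Tape.mk₂, Turing.Tape.mk',
      Turing.Tape.write]

theorem TapeRep.head_toTape (t : TapeRep k) : t.toTape.head = t.2.headI := by
  simp [toTape, Turing.Tape.mk₂]

theorem TapeRep.primrec_act : Primrec₂ (TapeRep.act : TapeRep k → ActCode k → TapeRep k) := by
  refine Primrec.option_casesOn Primrec.snd Primrec.fst (Primrec.sumCasesOn Primrec.snd
    (Primrec.cond Primrec.snd ?_ ?_) ?_)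
  · have h : Primrec fun b : ((TapeRep k × ActCode k) × (Bool ⊕ Symb k)) × Bool => b.1.1.1 :=
      Primrec.fst.comp (Primrec.fst.comp Primrec.fst)
    exact (Primrec.list_cons.comp (Primrec.list_headI.comp (Primrec.snd.comp h))
      (Primrec.fst.comp h)).pair (Primrec.list_tail.comp (Primrec.snd.comp h))
  · have h : Primrec fun b : ((TapeRep k × ActCode k) × (Bool ⊕ Symb k)) × Bool => b.1.1.1 :=
      Primrec.fst.comp (Primrec.fst.comp Primrec.fst)
    exact (Primrec.list_tail.comp (Primrec.fst.comp h)).pair (Primrec.list_cons.comp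
      (Primrec.list_headI.comp (Primrec.fst.comp h)) (Primrec.snd.comp h))
  · have h : Primrec fun b : ((TapeRep k × ActCode k) × (Bool ⊕ Symb k)) × Symb k => b.1.1.1 :=
      Primrec.fst.comp (Primrec.fst.comp Primrec.fst)
    exact (Primrec.fst.comp h).pair (Primrec.list_cons.comp Primrec.snd
      (Primrec.list_tail.comp (Primrec.snd.comp h)))

/-- The digit a symbol stands for. -/
def Symb.digit? : Symb k → Option Bool
  | .bit b => some b
  | _ => none

theorem primrec_leadingBits : Primrec (leadingBits : List (Symb k) → List Bool) := by
  have h : Primrec₂ fun (_ : List (Symb k)) (a : Symb k × List Bool) =>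
      (a.1.digit?.map fun b => b :: a.2).getD [] :=
    Primrec.option_getD.comp (Primrec.option_map ((Primrec.dom_finite Symb.digit?).comp
      (Primrec.fst.comp Primrec.snd)) (Primrec.list_cons.comp Primrec.snd
        (Primrec.snd.comp (Primrec.snd.comp Primrec.fst)))) (.const [])
  refine (Primrec.list_foldr Primrec.id (.const []) h).of_eq fun l => ?_
  induction l with
  | nil => rfl
  | cons a l ih =>
    rw [id, List.foldr_cons] at *
    rw [ih]
    cases a <;> rfl

/-- The number represented by a list of binary digits. -/
def ofDigits (l : List Bool) : ℕ := l.foldl (fun v b => 2 * v + b.toNat) 0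

theorem readNumber_toTape (t : TapeRep k) : readNumber t.toTape = ofDigits (leadingBits t.2) := by
  simp only [readNumber, TapeRep.toTape, Turing.Tape.mk₂, Turing.Tape.mk'_right₀]
  rfl

theorem primrec_ofDigits_leadingBits :
    Primrec fun t : TapeRep k => ofDigits (leadingBits t.2) := by
  have h : Primrec fun t : TapeRep k => leadingBits t.2 := primrec_leadingBits.comp Primrec.snd
  refine Primrec.list_foldl (h := fun _ a => 2 * a.1 + a.2.toNat) h (.const 0) ?_
  exact Primrec.nat_add.comp
    (Primrec.nat_mul.comp (.const 2) (Primrec.fst.comp Primrec.snd))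
    ((Primrec.dom_bool Bool.toNat).comp (Primrec.snd.comp Primrec.snd))

theorem primrec_binary : Primrec binary := by
  -- Each step moves the lowest digit to the front of the accumulator, which leaves the most
  -- significant digit first. Halving strictly decreases a nonzero number, so `m` steps suffice for
  -- `m`.
  let step (a : ℕ × List Bool) : ℕ × List Bool :=
    (a.1.div2, if a.1 = 0 then a.2 else a.1.bodd :: a.2)
  have hstep : Primrec step := (Primrec.nat_div2.comp Primrec.fst).pair
    (Primrec.ite (Primrec.eq.comp Primrec.fst (.const 0)) Primrec.snd
      (Primrec.list_cons.comp (Primrec.nat_bodd.comp Primrec.fst) Primrec.snd))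
  have key (i m : ℕ) (l : List Bool) (h : m ≤ i) :
      (step^[i] (m, l)).2 = (Nat.bits m).reverse ++ l := by
    induction i generalizing m l with
    | zero => simp [Nat.le_zero.1 h]
    | succ i ih =>
      rw [Function.iterate_succ_apply]
      by_cases hm : m = 0
      · simpa [step, hm] using ih 0 l (by omega)
      · have h₁ : Nat.bits m = m.bodd :: Nat.bits m.div2 := by
          conv_lhs => rw [← Nat.bit_bodd_div2 m]
          refine Nat.bits_append_bit _ _ fun h => ?_
          by_contra hb
          have := Nat.bit_bodd_div2 m
          simp_all
        have h₂ : m.div2 ≤ i := by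
          rw [Nat.div2_val]
          omega
        simp only [step, hm, ↓reduceIte]
        rw [ih _ _ h₂, h₁]
        simp
  refine (Primrec.ite (Primrec.eq.comp .id (.const 0)) (.const [false])
    (Primrec.snd.comp (Primrec.nat_iterate .id (Primrec.pair .id (.const []))
      (hstep.comp Primrec.snd).to₂))).of_eq fun m => ?_
  have h := key m m [] le_rfl
  rw [List.append_nil] at h
  simp only [binary, ← h]
  rfl

/-- The numerical inputs as they are written on the work tape. -/
def inputTape (k : ℕ) (n : List ℕ) : TapeRep k :=
  ([], (n.flatMap fun i => Symb.blank :: (binary i).map Symb.bit).tail)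

theorem primrec_inputTape : Primrec (inputTape k) := by
  refine Primrec.pair (.const []) (Primrec.list_tail.comp (Primrec.list_flatMap .id ?_))
  exact Primrec.list_cons.comp (.const _) (Primrec.list_map (primrec_binary.comp Primrec.snd)
    ((Primrec.dom_bool Symb.bit).comp Primrec.snd))

theorem tail_flatMap_cons {α β : Type*} (b : β) (f : α → List β) (l : List α) :
    (l.flatMap fun a => b :: f a).tail = List.intercalate [b] (l.map f) := by
  induction l with
  | nil => rfl
  | cons a l ih =>
    cases l with
    | nil => simp [List.intercalate]
    | cons a' l =>
      simp only [List.map_cons, List.flatMap_cons, List.cons_append, List.tail_cons] at ih ⊢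
      rw [ih]
      simp [List.intercalate]

theorem toTape_inputTape {p : ℕ} (n : Fin p → ℕ) : (inputTape k (List.ofFn n)).toTape =
    Turing.Tape.mk₁ (List.intercalate [Symb.blank]
      (List.ofFn fun i => (binary (n i)).map Symb.bit)) := by
  rw [inputTape, tail_flatMap_cons, List.map_ofFn]
  rfl

end

/-! ### Simulating the master with conjectured zero-tests -/

namespace MSMachine

variable {q : ℕ}

/-- Configurations of the simulation of the master: the state, the tapes and the bit of the master,
the programs of the slave calls so far, and the conjectured results of the zero-tests so
far. -/
abbrev SimCfg (M : MSMachine q) : Type :=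
  MState M.numStates × TapeRep M.numAux × TapeRep M.numAux × Bool × List ℕ ×
    List (List ℕ × Bool)

/-- The transition table of the master. -/
def transition (M : MSMachine q)
    (d : MState M.numStates × Symb M.numAux × Symb M.numAux × Bool) :
    Option (MState M.numStates × ActCode M.numAux × ActCode M.numAux) :=
  match d.1 with
  | .std r => if r = M.halt then none else
      (M.command r d.2.1 d.2.2.1 d.2.2.2).map fun c => (c.1, actCode c.2.1, actCode c.2.2)
  | .call => M.callNext.map fun r => (r, none, none)
  | .test => M.testNext.map fun r => (r, none, none)

/-- One step of the simulation with a conjecture `b` on the result of a zero-test; `r` is a program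
that extracts the tape that is tested. -/
def simStep (M : MSMachine q) (r : ℕ) (R : M.SimCfg) (b : Bool) : Option M.SimCfg :=
  (M.transition (R.1, R.2.1.2.headI, R.2.2.1.2.headI, R.2.2.2.1)).map fun t =>
    (t.1, R.2.1.act t.2.1, R.2.2.1.act t.2.2,
      if R.1 = .test then b else R.2.2.2.1,
      if R.1 = .call then ofDigits (leadingBits R.2.2.1.2) :: R.2.2.2.2.1 else R.2.2.2.2.1,
      if R.1 = .test then (r :: R.2.2.2.2.1, b) :: R.2.2.2.2.2 else R.2.2.2.2.2)

theorem primrec_simStep (M : MSMachine q) (r : ℕ) : Primrec₂ (M.simStep r) := by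
  have h₀ : Primrec fun a : M.SimCfg × Bool => a.1 := Primrec.fst
  have h₁ : Primrec fun a : M.SimCfg × Bool => a.1.1 := Primrec.fst.comp h₀
  have t₁ : Primrec fun a : M.SimCfg × Bool => a.1.2 := Primrec.snd.comp h₀
  have h₂ : Primrec fun a : M.SimCfg × Bool => a.1.2.1 := Primrec.fst.comp t₁
  have t₂ : Primrec fun a : M.SimCfg × Bool => a.1.2.2 := Primrec.snd.comp t₁
  have h₃ : Primrec fun a : M.SimCfg × Bool => a.1.2.2.1 := Primrec.fst.comp t₂
  have t₃ : Primrec fun a : M.SimCfg × Bool => a.1.2.2.2 := Primrec.snd.comp t₂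
  have h₄ : Primrec fun a : M.SimCfg × Bool => a.1.2.2.2.1 := Primrec.fst.comp t₃
  have t₄ : Primrec fun a : M.SimCfg × Bool => a.1.2.2.2.2 := Primrec.snd.comp t₃
  have h₅ : Primrec fun a : M.SimCfg × Bool => a.1.2.2.2.2.1 := Primrec.fst.comp t₄
  have h₆ : Primrec fun a : M.SimCfg × Bool => a.1.2.2.2.2.2 := Primrec.snd.comp t₄
  have hb : Primrec fun a : M.SimCfg × Bool => a.2 := Primrec.snd
  have hs (s : MState M.numStates) : PrimrecPred fun a : M.SimCfg × Bool => a.1.1 = s :=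
    Primrec.eq.comp h₁ (.const s)
  have hL : Primrec fun a : M.SimCfg × Bool => if a.1.1 = .call then
      ofDigits (leadingBits a.1.2.2.1.2) :: a.1.2.2.2.2.1 else a.1.2.2.2.2.1 :=
    Primrec.ite (hs .call) (Primrec.list_cons.comp (primrec_ofDigits_leadingBits.comp h₃) h₅) h₅
  have hK : Primrec fun a : M.SimCfg × Bool => if a.1.1 = .test then
      (r :: a.1.2.2.2.2.1, a.2) :: a.1.2.2.2.2.2 else a.1.2.2.2.2.2 :=
    Primrec.ite (hs .test) (Primrec.list_cons.comp
      ((Primrec.list_cons.comp (.const r) h₅).pair hb) h₆) h₆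
  have hc : Primrec fun a : M.SimCfg × Bool =>
      if a.1.1 = .test then a.2 else a.1.2.2.2.1 := Primrec.ite (hs .test) hb h₄
  have htr : Primrec fun a : M.SimCfg × Bool =>
      M.transition (a.1.1, a.1.2.1.2.headI, a.1.2.2.1.2.headI, a.1.2.2.2.1) :=
    (Primrec.dom_finite M.transition).comp (h₁.pair
      ((Primrec.list_headI.comp (Primrec.snd.comp h₂)).pair
        ((Primrec.list_headI.comp (Primrec.snd.comp h₃)).pair h₄)))
  refine Primrec.option_map htr ?_
  exact (Primrec.fst.comp Primrec.snd).pair <|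
    (TapeRep.primrec_act.comp (h₂.comp Primrec.fst)
      (Primrec.fst.comp (Primrec.snd.comp Primrec.snd))).pair <|
    (TapeRep.primrec_act.comp (h₃.comp Primrec.fst)
      (Primrec.snd.comp (Primrec.snd.comp Primrec.snd))).pair <|
    (hc.comp Primrec.fst).pair <| (hL.comp Primrec.fst).pair (hK.comp Primrec.fst)

/-- The simulation matches the computation with input `x`. -/
def Matches (M : MSMachine q) (x : Baire) (C : M.Cfg) (R : M.SimCfg) : Prop :=
  C.state = R.1 ∧ C.work = R.2.1.toTape ∧ C.board = R.2.2.1.toTape ∧ C.bit = R.2.2.2.1 ∧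
    join C.slaves ∈ iterPsi x R.2.2.2.2.1

variable {M : MSMachine q} {x : Baire} {r : ℕ}

theorem mem_iterPsi_test (hr : ∀ y, Psi r y = Part.some (split y M.testTape)) {C : M.Cfg}
    {R : M.SimCfg} (h : M.Matches x C R) :
    C.slaves M.testTape ∈ iterPsi x (r :: R.2.2.2.2.1) := by
  refine Part.mem_bind_iff.2 ⟨_, h.2.2.2.2, ?_⟩
  rw [hr, split_join]
  exact Part.mem_some _

theorem chi_eq_one_iff {y : Baire} : chi y = 1 ↔ y = 0 := by
  simp [chi]

/-- The simulation follows an actual step once the conjecture is the true result of the zero-test;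
outside the test state the Boolean is irrelevant. -/
theorem Matches.simStep_eq {C C' : M.Cfg} {R : M.SimCfg} (h : M.Matches x C R)
    (hC : M.Yields C C') (hr : ∀ y, Psi r y = Part.some (split y M.testTape)) :
    ∃ b R', M.simStep r R b = some R' ∧ M.Matches x C' R' ∧
      (Correct x R.2.2.2.2.2 → Correct x R'.2.2.2.2.2) := by
  have ht := mem_iterPsi_test hr h
  obtain ⟨st, wk, bd, c, l, K⟩ := R
  obtain ⟨h₁, h₂, h₃, h₄, h₅⟩ := h
  simp only at h₁ h₂ h₃ h₄ h₅ ht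
  cases hC with
  | standard s s' a b hs hne hcmd =>
    have e : st = .std s := h₁.symm.trans hs
    subst e
    rw [h₂, h₃, h₄, TapeRep.head_toTape, TapeRep.head_toTape] at hcmd
    refine ⟨false, (s', wk.act (actCode a), bd.act (actCode b), c, l, K), ?_, ?_, id⟩
    · simp [simStep, transition, hne, hcmd]
    · exact ⟨rfl, by rw [TapeRep.toTape_act, h₂], by rw [TapeRep.toTape_act, h₃], h₄, h₅⟩
  | call s' y hs hnext hy =>
    have e : st = .call := h₁.symm.trans hs
    subst e
    refine ⟨false, (s', wk, bd, c, ofDigits (leadingBits bd.2) :: l, K), ?_, ?_, id⟩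
    · simp [simStep, transition, hnext, TapeRep.act]
    · refine ⟨rfl, h₂, h₃, h₄, ?_⟩
      simp only [join_split]
      rw [h₃, readNumber_toTape] at hy
      exact Part.mem_bind_iff.2 ⟨_, h₅, hy⟩
  | test s' hs hnext =>
    have e : st = .test := h₁.symm.trans hs
    subst e
    refine ⟨decide (chi (C.slaves M.testTape) = 1), (s', wk, bd,
      decide (chi (C.slaves M.testTape) = 1), l,
      (r :: l, decide (chi (C.slaves M.testTape) = 1)) :: K), ?_, ?_, ?_⟩
    · simp [simStep, transition, hnext, TapeRep.act]
    · exact ⟨rfl, h₂, h₃, rfl, h₅⟩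
    · intro hK κ hκ
      rcases List.mem_cons.1 hκ with rfl | hκ
      · exact ⟨_, ht, by simp [chi_eq_one_iff]⟩
      · exact hK κ hκ

/-- The tested sequence is defined here, because the slave tapes exist. Consistency therefore makes
the conjecture the true bit, and every actual successor matches the simulated one. -/
theorem Matches.yields {C C' : M.Cfg} {R R' : M.SimCfg} {b : Bool} (h : M.Matches x C R)
    (hR : M.simStep r R b = some R') (hr : ∀ y, Psi r y = Part.some (split y M.testTape))
    (hK : Consistent x R'.2.2.2.2.2) (hC : M.Yields C C') : M.Matches x C' R' := by
  have ht := mem_iterPsi_test hr h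
  obtain ⟨st, wk, bd, c, l, K⟩ := R
  obtain ⟨h₁, h₂, h₃, h₄, h₅⟩ := h
  simp only at h₁ h₂ h₃ h₄ h₅ ht
  cases hC with
  | standard s s' a b hs hne hcmd =>
    have e : st = .std s := h₁.symm.trans hs
    subst e
    rw [h₂, h₃, h₄, TapeRep.head_toTape, TapeRep.head_toTape] at hcmd
    simp only [simStep, transition, hne, ↓reduceIte, hcmd, Option.map_some, Option.some.injEq,
      reduceCtorEq] at hR
    subst hR
    exact ⟨rfl, by rw [TapeRep.toTape_act, h₂], by rw [TapeRep.toTape_act, h₃], h₄, h₅⟩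
  | call s' y hs hnext hy =>
    have e : st = .call := h₁.symm.trans hs
    subst e
    simp only [simStep, transition, hnext, ↓reduceIte, Option.map_some, Option.some.injEq,
      reduceCtorEq] at hR
    subst hR
    refine ⟨rfl, h₂, h₃, h₄, ?_⟩
    simp only [join_split]
    rw [h₃, readNumber_toTape] at hy
    exact Part.mem_bind_iff.2 ⟨_, h₅, hy⟩
  | test s' hs hnext =>
    have e : st = .test := h₁.symm.trans hs
    subst e
    simp only [simStep, transition, hnext, ↓reduceIte, Option.map_some, Option.some.injEq,
      reduceCtorEq] at hR
    subst hR
    refine ⟨rfl, h₂, h₃, ?_, h₅⟩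
    have hb : b = true ↔ C.slaves M.testTape = 0 := hK (r :: l, b) (by simp) _ ht
    rw [Bool.eq_iff_iff, decide_eq_true_iff, chi_eq_one_iff, hb]

theorem ne_halt_of_simStep {R R' : M.SimCfg} {b : Bool} (hR : M.simStep r R b = some R') :
    R.1 ≠ .std M.halt := by
  intro h
  simp [simStep, transition, h] at hR

/-- Apart from missing commands, which the simulation shares, only a divergent slave call can block
the machine, and `hL` excludes it. -/
theorem Matches.exists_yields {C : M.Cfg} {R R' : M.SimCfg} {b : Bool} (h : M.Matches x C R)
    (hR : M.simStep r R b = some R') (hL : (iterPsi x R'.2.2.2.2.1).Dom) :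
    ∃ C', M.Yields C C' := by
  have hne := ne_halt_of_simStep hR
  obtain ⟨st, wk, bd, c, l, K⟩ := R
  obtain ⟨h₁, h₂, h₃, h₄, h₅⟩ := h
  simp only at h₁ h₂ h₃ h₄ h₅ hne
  obtain ⟨t, ht, rfl⟩ := Option.map_eq_some_iff.1 hR
  simp only [transition] at ht
  cases st with
  | std s =>
    have hs : s ≠ M.halt := fun e => hne (congrArg _ e)
    simp only [hs, ↓reduceIte, Option.map_eq_some_iff] at ht
    obtain ⟨⟨s', a, a'⟩, ht, -⟩ := ht
    exact ⟨_, .standard C s s' a a' h₁ hs (by rw [h₂, h₃, h₄, TapeRep.head_toTape,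
      TapeRep.head_toTape, ht])⟩
  | call =>
    obtain ⟨s', ht, -⟩ := Option.map_eq_some_iff.1 ht
    simp only [↓reduceIte] at hL
    obtain ⟨y, hy⟩ := Part.dom_iff_mem.1 hL
    obtain ⟨y', hy', hy⟩ := Part.mem_bind_iff.1 hy
    obtain rfl := Part.mem_unique hy' h₅
    rw [← readNumber_toTape, ← h₃] at hy
    exact ⟨_, .call C s' y h₁ ht hy⟩
  | test =>
    obtain ⟨s', ht, -⟩ := Option.map_eq_some_iff.1 ht
    exact ⟨_, .test C s' h₁ ht⟩

theorem simStep_mono {R R' : M.SimCfg} {b : Bool} (hR : M.simStep r R b = some R') :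
    R.2.2.2.2.1 <:+ R'.2.2.2.2.1 ∧ R.2.2.2.2.2 ⊆ R'.2.2.2.2.2 := by
  obtain ⟨t, -, rfl⟩ := Option.map_eq_some_iff.1 hR
  dsimp only
  constructor
  · split_ifs
    · exact List.suffix_cons _ _
    · exact List.suffix_rfl
  · split_ifs
    · exact List.subset_cons_self _ _
    · exact List.Subset.refl _

/-- The simulation with a list of conjectures, one for each step. -/
def simRun (M : MSMachine q) (r : ℕ) : List Bool → M.SimCfg → Option M.SimCfg
  | [], R => some R
  | b :: w, R => (M.simStep r R b).bind (simRun M r w)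

theorem simRun_eq_foldl (M : MSMachine q) (r : ℕ) (w : List Bool) (o : Option M.SimCfg) :
    o.bind (M.simRun r w) = w.foldl (fun o b => o.bind fun R => M.simStep r R b) o := by
  induction w generalizing o with
  | nil => cases o <;> rfl
  | cons b w ih =>
    rw [List.foldl_cons, ← ih]
    cases o <;> rfl

theorem simRun_mono {w : List Bool} {R R' : M.SimCfg} (hR : M.simRun r w R = some R') :
    R.2.2.2.2.1 <:+ R'.2.2.2.2.1 ∧ R.2.2.2.2.2 ⊆ R'.2.2.2.2.2 := by
  induction w generalizing R with
  | nil =>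
    obtain rfl := Option.some.inj hR
    exact ⟨List.suffix_rfl, List.Subset.refl _⟩
  | cons b w ih =>
    obtain ⟨R₁, h₁, hR⟩ := Option.bind_eq_some_iff.1 hR
    exact ⟨(simStep_mono h₁).1.trans (ih hR).1, List.Subset.trans (simStep_mono h₁).2 (ih hR).2⟩

theorem iterPsi_dom_of_suffix {l l' : List ℕ} (h : l <:+ l') (hl : (iterPsi x l').Dom) :
    (iterPsi x l).Dom := by
  obtain ⟨t, rfl⟩ := h
  rw [iterPsi_append] at hl
  exact hl.fst

/-- Along a consistent simulation that halts, the computation reaches a matching halting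
configuration if and only if all slave calls of the simulation are defined. -/
theorem Matches.exists_halting {C : M.Cfg} {w : List Bool} {R R' : M.SimCfg}
    (h : M.Matches x C R) (hr : ∀ y, Psi r y = Part.some (split y M.testTape))
    (hR : M.simRun r w R = some R') (hK : Consistent x R'.2.2.2.2.2)
    (hL : (iterPsi x R'.2.2.2.2.1).Dom) :
    ∃ C', Relation.ReflTransGen M.Yields C C' ∧ M.Matches x C' R' := by
  induction w generalizing C R with
  | nil =>
    obtain rfl := Option.some.inj hR
    exact ⟨C, .refl, h⟩
  | cons b w ih =>
    obtain ⟨R₁, h₁, hR⟩ := Option.bind_eq_some_iff.1 hR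
    have hm := simRun_mono hR
    obtain ⟨C₁, hC₁⟩ := h.exists_yields h₁ (iterPsi_dom_of_suffix hm.1 hL)
    obtain ⟨C', hC', h'⟩ := ih (h.yields h₁ hr (fun κ hκ => hK κ (hm.2 hκ)) hC₁) hR
    exact ⟨C', .head hC₁ hC', h'⟩

/-- Under consistent conjectures the machine and the simulation move in lockstep, and neither can
leave the halting state; so they halt together. -/
theorem Matches.of_halting {C C' : M.Cfg} {w : List Bool} {R R' : M.SimCfg}
    (h : M.Matches x C R) (hr : ∀ y, Psi r y = Part.some (split y M.testTape))
    (hR : M.simRun r w R = some R') (hK : Consistent x R'.2.2.2.2.2)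
    (hs : R'.1 = .std M.halt) (hC : Relation.ReflTransGen M.Yields C C')
    (hC' : C'.state = .std M.halt) : M.Matches x C' R' := by
  induction w generalizing C R with
  | nil =>
    obtain rfl := Option.some.inj hR
    rcases hC.cases_head with rfl | ⟨C₁, hC₁, -⟩
    · exact h
    · have h₁ := h.1.trans hs
      cases hC₁ with
      | standard s s' a b hs hne _ => exact absurd (MState.std.inj (hs.symm.trans h₁)) hne
      | call s' y hs _ _ => cases hs.symm.trans h₁
      | test s' hs _ => cases hs.symm.trans h₁
  | cons b w ih =>
    obtain ⟨R₁, h₁, hR⟩ := Option.bind_eq_some_iff.1 hR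
    rcases hC.cases_head with rfl | ⟨C₁, hC₁, hC⟩
    · exact absurd (h.1.symm.trans hC') (ne_halt_of_simStep h₁)
    · exact ih (h.yields h₁ hr (fun κ hκ => hK κ ((simRun_mono hR).2 hκ)) hC₁) hR hC

/-- A halting computation is matched by a simulation with correct conjectures. -/
theorem Matches.exists_simRun {C C' : M.Cfg} {R : M.SimCfg} (h : M.Matches x C R)
    (hr : ∀ y, Psi r y = Part.some (split y M.testTape))
    (hC : Relation.ReflTransGen M.Yields C C') (hK : Correct x R.2.2.2.2.2) :
    ∃ w R', M.simRun r w R = some R' ∧ M.Matches x C' R' ∧ Correct x R'.2.2.2.2.2 := by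
  induction hC using Relation.ReflTransGen.head_induction_on generalizing R with
  | refl => exact ⟨[], R, rfl, h, hK⟩
  | head hC _ ih =>
    obtain ⟨b, R₁, h₁, hm, hK₁⟩ := h.simStep_eq hC hr
    obtain ⟨w, R', hR', h'⟩ := ih hm (hK₁ hK)
    exact ⟨b :: w, R', by rw [simRun, h₁]; exact hR', h'⟩

/-- The initial configuration of the simulation, for a program `r` that prepares the slave
tapes. -/
def simInit (M : MSMachine q) (r : ℕ) (n : List ℕ) : M.SimCfg :=
  (.std M.start, inputTape M.numAux n, ([], []), false, [r], [])

theorem matches_init {p : ℕ} (n : Fin p → ℕ) (x : Fin (q + 1) → Baire)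
    (hr : ∀ y, Psi r y = Part.some (join (initSlaves M.w (split y : Fin (q + 1) → Baire)))) :
    M.Matches (join x) (M.init n x) (M.simInit r (List.ofFn n)) := by
  refine ⟨rfl, (toTape_inputTape n).symm, rfl, rfl, ?_⟩
  simp only [simInit, iterPsi, Part.bind_some, hr, split_join]
  exact Part.mem_some _

/-- The number of a program for the output, where `r` is a program that extracts the output tape. -/
def outputProgram (M : MSMachine q) (r : ℕ) (s : Srt) (R : M.SimCfg) : ℕ :=
  match s with
  | .nat => (OracleCode.const (ofDigits (leadingBits R.2.1.2))).toNat
  | .baire => r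

/-- Both kinds of output become one further program call: extraction of a tape, or a constant
sequence. The earlier calls stay in the list, so a numerical output is also undefined when one of
them diverges. -/
theorem mem_iterPsi_outputProgram (hr : ∀ y, Psi r y = Part.some (split y M.outTape))
    {C : M.Cfg} {R : M.SimCfg} (h : M.Matches x C R) (s : Srt) :
    s.toBaire (M.output C s) ∈ iterPsi x (M.outputProgram r s R :: R.2.2.2.2.1) := by
  refine Part.mem_bind_iff.2 ⟨_, h.2.2.2.2, ?_⟩
  cases s with
  | nat =>
    simp only [outputProgram, Psi_toNat (OracleCode.primComputes_const _), output, h.2.1,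
      readNumber_toTape]
    exact Part.mem_some _
  | baire =>
    simp only [outputProgram, hr, split_join]
    exact Part.mem_some _

/-- The result of the simulation: the programs that lead to the output, and the
conjectures. -/
def simulate (M : MSMachine q) (r₀ r₁ r₂ : ℕ) (s : Srt) (n : List ℕ) (w : ℕ) :
    Option (List ℕ × List (List ℕ × Bool)) :=
  (M.simRun r₁ ((decode w).getD []) (M.simInit r₀ n)).bind fun R =>
    if R.1 = .std M.halt then
      some (M.outputProgram r₂ s R :: R.2.2.2.2.1, R.2.2.2.2.2) else none

theorem primrec_simulate (M : MSMachine q) (r₀ r₁ r₂ : ℕ) (s : Srt) :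
    Primrec₂ (M.simulate r₀ r₁ r₂ s) := by
  have hinit : Primrec fun a : List ℕ × ℕ => some (M.simInit r₀ a.1) :=
    Primrec.option_some.comp <| (Primrec.const _).pair <|
      (primrec_inputTape.comp Primrec.fst).pair (.const _)
  have hrun : Primrec fun a : List ℕ × ℕ =>
      M.simRun r₁ ((decode a.2).getD []) (M.simInit r₀ a.1) := by
    refine (Primrec.list_foldl (f := fun a : List ℕ × ℕ => (decode a.2 : Option (List Bool)).getD [])
      (h := fun _ (b : Option M.SimCfg × Bool) => b.1.bind fun R => M.simStep r₁ R b.2)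
      (Primrec.option_getD.comp (Primrec.decode.comp Primrec.snd) (.const [])) hinit
      ?_).of_eq fun a => (M.simRun_eq_foldl r₁ _ _).symm
    exact Primrec.option_bind (Primrec.fst.comp Primrec.snd) ((M.primrec_simStep r₁).comp
      Primrec.snd (Primrec.snd.comp (Primrec.snd.comp Primrec.fst)))
  have hout : Primrec (M.outputProgram r₂ s) := by
    cases s with
    | nat =>
      have h : Primrec fun R : M.SimCfg => R.2.1 := Primrec.fst.comp Primrec.snd
      exact OracleCode.primrec_toNat_const.comp (primrec_ofDigits_leadingBits.comp h)
    | baire => exact .const r₂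
  have hL : Primrec fun R : M.SimCfg => R.2.2.2.2 :=
    Primrec.snd.comp (Primrec.snd.comp (Primrec.snd.comp Primrec.snd))
  have hfin : Primrec fun R : M.SimCfg => if R.1 = .std M.halt then
      some (M.outputProgram r₂ s R :: R.2.2.2.2.1, R.2.2.2.2.2) else none :=
    Primrec.ite (Primrec.eq.comp Primrec.fst (.const _)) (Primrec.option_some.comp
      ((Primrec.list_cons.comp hout (Primrec.fst.comp hL)).pair (Primrec.snd.comp hL))) (.const none)
  exact Primrec.option_bind hrun (hfin.comp Primrec.snd)

end MSMachine

/-- The auxiliary input `w` codes one Boolean per step. Consistent conjectures suffice for equality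
of the partial values, including the undefined case; correct ones are available whenever the machine
halts. -/
theorem exists_simulation {p q : ℕ} {s : Srt}
    {F : (Fin p → ℕ) → (Fin (q + 1) → Baire) → Part s.Val} (hF : MSComputable F) :
    ∃ G : List ℕ → ℕ → Option (List ℕ × List (List ℕ × Bool)), Primrec₂ G ∧
      (∀ n x w l K, G (List.ofFn n) w = some (l, K) → Consistent (join x) K →
        (F n x).map s.toBaire = iterPsi (join x) l) ∧
      ∀ n x, (F n x).Dom → ∃ w l K, G (List.ofFn n) w = some (l, K) ∧ Correct (join x) K := by
  obtain ⟨M, hM⟩ := hF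
  obtain ⟨c₀, h₀⟩ := OracleCode.exists_primComputes_initSlaves q M.w
  obtain ⟨c₁, h₁⟩ := OracleCode.exists_primComputes_split M.testTape
  obtain ⟨c₂, h₂⟩ := OracleCode.exists_primComputes_split M.outTape
  replace h₀ := Psi_toNat h₀
  replace h₁ := Psi_toNat h₁
  replace h₂ := Psi_toNat h₂
  refine ⟨_, M.primrec_simulate c₀.toNat c₁.toNat c₂.toNat s, fun n x w l K hG hK => ?_,
    fun n x hn => ?_⟩
  · obtain ⟨R, hR, hG⟩ := Option.bind_eq_some_iff.1 hG
    split_ifs at hG with hs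
    obtain ⟨rfl, rfl⟩ := Prod.mk.inj (Option.some.inj hG)
    have hinit := MSMachine.matches_init n x h₀
    refine Part.ext fun Y => ⟨fun hY => ?_, fun hY => ?_⟩
    · obtain ⟨y, hy, rfl⟩ := (Part.mem_map_iff _).1 hY
      obtain ⟨C, hC, hC', rfl⟩ := (hM n x y).1 hy
      exact MSMachine.mem_iterPsi_outputProgram h₂ (hinit.of_halting h₁ hR hK hs hC hC') s
    -- If the whole list including the output program has a value, then all slave calls are defined
    -- and the machine does reach the halting state.
    · obtain ⟨C, hC, hC'⟩ := hinit.exists_halting h₁ hR hK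
        (MSMachine.iterPsi_dom_of_suffix (List.suffix_cons _ _) (Part.dom_iff_mem.2 ⟨Y, hY⟩))
      rw [Part.mem_unique hY (MSMachine.mem_iterPsi_outputProgram h₂ hC' s)]
      exact Part.mem_map _ ((hM n x _).2 ⟨C, hC, hC'.1.trans hs, rfl⟩)
  · obtain ⟨y, hy⟩ := Part.dom_iff_mem.1 hn
    obtain ⟨C, hC, hC', -⟩ := (hM n x y).1 hy
    obtain ⟨w, R, hR, hm, hK⟩ := (MSMachine.matches_init n x h₀).exists_simRun h₁ hC
      (fun κ hκ => by simp [MSMachine.simInit] at hκ)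
    refine ⟨encode w, M.outputProgram c₂.toNat s R :: R.2.2.2.2.1, _, ?_, hK⟩
    simp only [MSMachine.simulate, encodek, Option.getD_some, hR, Option.bind_some]
    exact if_pos (hm.1.symm.trans hC')

end BaireComputability

theorem mainTheorem2 (p q : ℕ) (s : BaireComputability.Srt) :
    ∃ (T : (Fin (p + 2) → ℕ) → (Fin (q + 1) → BaireComputability.Baire) → Prop)
      (U : ℕ → (Fin (q + 1) → BaireComputability.Baire) → Part BaireComputability.Baire),
      BaireComputability.PrimRecPred T ∧
      BaireComputability.TTEComputable U ∧
      ∀ F : (Fin p → ℕ) → (Fin (q + 1) → BaireComputability.Baire) → Part s.Val,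
        BaireComputability.MSComputable F →
        ∃ e : ℕ, ∀ (n : Fin p → ℕ) (x : Fin (q + 1) → BaireComputability.Baire),
          (F n x).map s.toBaire =
            (BaireComputability.mu fun z => T (Matrix.vecCons e (Matrix.vecCons z n)) x).bind
              fun z => U z x := by
  obtain ⟨T, U, hT, hU, h⟩ := BaireComputability.exists_normalForm p q
  refine ⟨T, U, hT, hU, fun F hF => ?_⟩
  obtain ⟨G, hG, h₁, h₂⟩ := BaireComputability.exists_simulation hF
  exact h (fun n x => (F n x).map s.toBaire) G hG h₁ h₂
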